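/- Let $n\ge 1$, $J=\begin{bmatrix}0&\mathrm{Id}_n\\-\mathrm{Id}_n&0\end{bmatrix}$, let $t\mapsto A(t)$ $(t\in\mathbb R)$ be a continuous curve of real symmetric $2n\times 2n$ matrices, and let $\gamma$ solve $\gamma'(t)=JA(t)\gamma(t)$ with $\gamma(0)\in\mathrm{Sp}(2n,\mathbb R)$. (No positivity of $A$ is assumed.) Let $\lambda_0=e^{\sqrt{-1}\theta_0}$, $\theta_0\in\mathbb R$, be an eigenvalue of $\gamma(0)$, let $E=\ker(\lambda_0\mathrm{Id}-\gamma(0))^{2n}\subset\mathbb C^{2n}$ and $N=\dim E$. Let $j_1\ge\dots\ge j_m\ge1$ be the sizes of the Jordan blocks of $\gamma(0)$ for $\lambda_0$, and let $(\xi_{i,j})_{1\le i\le m,\,1\le j\le j_i}$ be any basis of $E$ with $\gamma(0)\xi_{i,j}=\lambda_0\xi_{i,j}-\xi_{i,j-1}$, $\xi_{i,0}=0$. Let $n_1>\dots>n_s\ge 1$ be the distinct block sizes and $m_\ell\ge 1$ the number of blocks of size $n_\ell$. With $\langle x,y\rangle=\sum_a x_a\bar y_a$, $(x,y)_G=\sqrt{-1}\langle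 x,Jy\rangle$ and $\eta_{i,j}=(-\sqrt{-1}\lambda_0)^j\xi_{i,j}$, define the $m\times m$ matrices $$S_{i,i'}=\langle A(0)\eta_{i,1},\eta_{i',1}\rangle,\qquad X_{i,i'}=(\eta_{i,j_i},\eta_{i',1})_G,\qquad \Lambda=\mathrm{diag}\big((-1)^{j_i-1}(\sqrt{-1}\lambda_0)^{j_i}\big).$$ Define $c_k(t)$ by $\det(\lambda\,\mathrm{Id}-\gamma(t))=\sum_{k=0}^{2n}c_k(t)(\lambda-\lambda_0)^k$. For linear maps $A_1,A_2$ on $\mathbb C^{2n}$ let $\bigwedge(2n,k_1,k_2,A_1,A_2)$ be the scalar by which the linear map $$v_1\wedge\dots\wedge v_{2n}\mapsto\sum_{\sigma}M_{\sigma_1}v_1\wedge\dots\wedge M_{\sigma_{2n}}v_{2n},\qquad M_0=\mathrm{Id},\ M_1=A_1,\ M_2=A_2,$$ acts on the one-dimensional space $\Lambda^{2n}(\mathbb C^{2n})$, the sum being over all $\sigma\in\{0,1,2\}^{2n}$ with exactly $k_1$ entries equal to $1$ and $k_2$ entries equal to $2$. For $0\le k<N$ put $$\varphi(k)=\min\Big\{i\in\{1,\dots,m\}:\sum_{i'\le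 i}j_{i'}\ge N-k\Big\},$$ $$\mathcal I_k=\big\{I\subset\{1,\dots,m\}:\ \sharp I=\varphi(k),\ j_i\ge j_{\varphi(k)}\ \forall i\in I,\ j_i\le j_{\varphi(k)}\ \forall i\notin I\big\}.$$ Then $N=\sum_i j_i$, the matrix $X$ is invertible (put $d=SX^{-1}\Lambda$), and the following hold. 1. $c_N(0)=\lim_{\lambda\to\lambda_0}\det(\lambda\,\mathrm{Id}-\gamma(0))/(\lambda-\lambda_0)^N$. 2. For every $0\le k<N$, also $\varphi(k)=\min\{i\in\{1,\dots,m\}:\sum_{i'>i}j_{i'}\le k\}$, and as $t\to0$ $$c_k(t)=(-t)^{\varphi(k)}\bigwedge\big(2n,\,2n-k-\varphi(k),\,\varphi(k),\,\lambda_0\mathrm{Id}-\gamma(0),\,\gamma'(0)\big)+o(t^{\varphi(k)}).$$ 3. If $0\le k<N$ and $k=\sum_{i>\varphi(k)}j_i$, then as $t\to0$ $$c_k(t)=(-1)^{N-k}t^{\varphi(k)}c_N(0)\sum_{I\in\mathcal I_k}\det\big[(d_{i,i'})_{i,i'\in I}\big]+o(t^{\varphi(k)}),$$ and for each $\ell=1,\dots,s$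 the equality $k=\sum_{\ell'>\ell}m_{\ell'}n_{\ell'}$ holds if and only if $\varphi(k)=\sum_{\ell'\le\ell}m_{\ell'}$. 4. If $k=\sum_{\ell'>\ell}m_{\ell'}n_{\ell'}$ for some $\ell\in\{1,\dots,s\}$, then $k<N$, $k=\sum_{i>\varphi(k)}j_i$, $\mathcal I_k=\big\{\{1,\dots,\sum_{\ell'\le\ell}m_{\ell'}\}\big\}$, and as $t\to0$ $$c_k(t)=(-1)^{N-k}t^{\varphi(k)}c_N(0)\det\big[(d_{i,i'})_{1\le i,i'\le\varphi(k)}\big]+o(t^{\varphi(k)}).$$ -/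

import Mathlib

open Filter Topology Asymptotics
open scoped BigOperators Matrix

noncomputable section

namespace SymplecticPath

/-! ### Mixed exterior powers of two linear maps -/

section Exterior

variable {K V : Type*} [Field K] [AddCommGroup V] [Module K V]

/-- One of the three maps `Id`, `A₁`, `A₂`. -/
def chooseMap (A₁ A₂ : V →ₗ[K] V) (a : Fin 3) : V →ₗ[K] V :=
  if a = 1 then A₁ else if a = 2 then A₂ else LinearMap.id

/-- The assignments `σ ∈ {0,1,2}^d` taking the value `1` exactly `k₁` times and the value `2`
exactly `k₂` times. -/
def assignments (d k₁ k₂ : ℕ) : Finset (Fin d → Fin 3) :=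
  Finset.univ.filter fun σ =>
    (Finset.univ.filter fun i => σ i = 1).card = k₁ ∧
      (Finset.univ.filter fun i => σ i = 2).card = k₂

/-- Precomposing with a permutation of the positions preserves `assignments`. -/
theorem comp_mem_assignments {d k₁ k₂ : ℕ} {σ : Fin d → Fin 3} (e : Equiv.Perm (Fin d))
    (h : σ ∈ assignments d k₁ k₂) : σ ∘ e ∈ assignments d k₁ k₂ := by
  have key : ∀ a : Fin 3, (Finset.univ.filter fun i => (σ ∘ e) i = a).card
      = (Finset.univ.filter fun i => σ i = a).card := by
    intro a
    exact Finset.card_equiv e (by simp)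
  simp only [assignments, Finset.mem_filter, Finset.mem_univ, true_and] at h ⊢
  rw [key, key]
  exact h

/-- The map `(v₁, …, v_d) ↦ ∑_σ M_{σ₁} v₁ ∧ ⋯ ∧ M_{σ_d} v_d`, where `σ` runs over `assignments`
and `M₀ = Id`, `M₁ = A₁`, `M₂ = A₂`. -/
def mixedWedgeAlternating (d k₁ k₂ : ℕ) (A₁ A₂ : V →ₗ[K] V) : V [⋀^Fin d]→ₗ[K] (⋀[K]^d V) where
  toMultilinearMap := ∑ σ ∈ assignments d k₁ k₂,
    (exteriorPower.ιMulti K d (M := V)).toMultilinearMap.compLinearMap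
      fun i => chooseMap A₁ A₂ (σ i)
  map_eq_zero_of_eq' := by
    intro v i j hv hij
    simp only [MultilinearMap.toFun_eq_coe, sum_apply,
      MultilinearMap.compLinearMap_apply, AlternatingMap.coe_multilinearMap]
    refine Finset.sum_involution (fun σ _ => σ ∘ Equiv.swap i j) ?_ ?_ ?_ ?_
    · intro σ _
      have h : (fun l => chooseMap A₁ A₂ ((σ ∘ Equiv.swap i j) l) (v l))
          = (fun l => chooseMap A₁ A₂ (σ l) (v l)) ∘ Equiv.swap i j := by
        funext l
        have hl : v (Equiv.swap i j l) = v l := by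
          by_cases h1 : l = i
          · subst h1; simp [hv]
          · by_cases h2 : l = j
            · subst h2; simp [hv]
            · rw [Equiv.swap_apply_of_ne_of_ne h1 h2]
        simp [hl]
      rw [h, AlternatingMap.map_swap _ _ hij]
      exact add_neg_cancel _
    · intro σ _ hne heq
      apply hne
      have h1 : σ i = σ j := by
        have := congrFun heq j
        simpa using this
      exact AlternatingMap.map_eq_zero_of_eq _ _ (by simp [h1, hv]) hij
    · intro σ hσ
      exact comp_mem_assignments _ hσ
    · intro σ _
      funext l
      simp

/-- The linear endomorphism `⋀(d, k₁, k₂, A₁, A₂)` of the `d`-th exterior power of `V`. -/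
def mixedWedge (d k₁ k₂ : ℕ) (A₁ A₂ : V →ₗ[K] V) : (⋀[K]^d V) →ₗ[K] (⋀[K]^d V) :=
  exteriorPower.alternatingMapLinearEquiv (mixedWedgeAlternating d k₁ k₂ A₁ A₂)

/-- The defining formula of `mixedWedge` on decomposable elements. -/
theorem mixedWedge_ιMulti (d k₁ k₂ : ℕ) (A₁ A₂ : V →ₗ[K] V) (v : Fin d → V) :
    mixedWedge d k₁ k₂ A₁ A₂ (exteriorPower.ιMulti K d v) =
      ∑ σ ∈ assignments d k₁ k₂,
        exteriorPower.ιMulti K d fun i => chooseMap A₁ A₂ (σ i) (v i) := by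
  rw [mixedWedge, exteriorPower.alternatingMapLinearEquiv_apply_ιMulti]
  change (∑ σ ∈ assignments d k₁ k₂,
    (exteriorPower.ιMulti K d (M := V)).toMultilinearMap.compLinearMap
      fun i => chooseMap A₁ A₂ (σ i)) v = _
  simp [MultilinearMap.compLinearMap_apply]

/-- The scaling factor of `⋀(d, k₁, k₂, A₁, A₂)` when `d = dim V`: an endomorphism of a
one-dimensional space is multiplication by its trace. -/
def mixedWedgeScalar (d k₁ k₂ : ℕ) (A₁ A₂ : V →ₗ[K] V) : K :=
  LinearMap.trace K (⋀[K]^d V) (mixedWedge d k₁ k₂ A₁ A₂)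

/-- In top degree, `mixedWedge` is multiplication by `mixedWedgeScalar`. -/
theorem mixedWedge_eq_smul [FiniteDimensional K V] {d : ℕ} (hd : Module.finrank K V = d)
    (k₁ k₂ : ℕ) (A₁ A₂ : V →ₗ[K] V) (ω : ⋀[K]^d V) :
    mixedWedge d k₁ k₂ A₁ A₂ ω = mixedWedgeScalar d k₁ k₂ A₁ A₂ • ω := by
  have h1 : Module.finrank K (⋀[K]^d V) = 1 := by
    rw [exteriorPower.finrank_eq, hd, Nat.choose_self]
  obtain ⟨c, hc, -⟩ := LinearMap.existsUnique_eq_smul_id_of_finrank_eq_one h1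
    (mixedWedge d k₁ k₂ A₁ A₂)
  have : mixedWedgeScalar d k₁ k₂ A₁ A₂ = c := by
    rw [mixedWedgeScalar, hc, map_smul, LinearMap.trace_id, h1]
    simp
  rw [this, hc]
  simp

end Exterior

/-! ### Symplectic notation -/

/-- The matrix `J_{2n} = [[0, Id], [-Id, 0]]`. -/
def J2n (n : ℕ) (R : Type*) [CommRing R] : Matrix (Fin n ⊕ Fin n) (Fin n ⊕ Fin n) R :=
  Matrix.fromBlocks 0 1 (-1) 0

/-- A real matrix regarded as a complex matrix. -/
def toC {ι : Type*} (M : Matrix ι ι ℝ) : Matrix ι ι ℂ := M.map Complex.ofReal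

/-- `⟨x, y⟩ = ∑ x_a conj(y_a)`, linear in the first variable. -/
def herm {ι : Type*} [Fintype ι] (x y : ι → ℂ) : ℂ := ∑ a, x a * star (y a)

/-- The Krein form `(x, y)_G = i ⟨x, J y⟩`. -/
def kreinForm {n : ℕ} (x y : Fin n ⊕ Fin n → ℂ) : ℂ :=
  Complex.I * herm x (J2n n ℂ *ᵥ y)

/-- The invariant space `ker (μ Id - M)^{2n}`. -/
def invSpace {n : ℕ} (M : Matrix (Fin n ⊕ Fin n) (Fin n ⊕ Fin n) ℂ) (μ : ℂ) :
    Submodule ℂ (Fin n ⊕ Fin n → ℂ) :=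
  LinearMap.ker (Matrix.toLin' ((μ • (1 : Matrix (Fin n ⊕ Fin n) (Fin n ⊕ Fin n) ℂ) - M) ^ (2 * n)))

/-- The coefficient `c_k` in `det(z Id - M) = ∑_k c_k (z - μ)^k`. -/
def charCoeff {n : ℕ} (M : Matrix (Fin n ⊕ Fin n) (Fin n ⊕ Fin n) ℂ) (μ : ℂ) (k : ℕ) : ℂ :=
  (Polynomial.taylor μ M.charpoly).coeff k

theorem det_eq_sum_charCoeff {n : ℕ} (M : Matrix (Fin n ⊕ Fin n) (Fin n ⊕ Fin n) ℂ) (μ z : ℂ) :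
    (z • (1 : Matrix (Fin n ⊕ Fin n) (Fin n ⊕ Fin n) ℂ) - M).det =
      ∑ k ∈ Finset.range (2 * n + 1), charCoeff M μ k * (z - μ) ^ k := by
  have h1 : (z • (1 : Matrix (Fin n ⊕ Fin n) (Fin n ⊕ Fin n) ℂ) - M).det = M.charpoly.eval z := by
    rw [Matrix.eval_charpoly]
    congr 2
    ext a b
    simp [Matrix.scalar_apply, Matrix.smul_apply, Matrix.one_apply, Matrix.diagonal_apply]
  have h2 : M.charpoly.eval z = (Polynomial.taylor μ M.charpoly).eval (z - μ) := by
    rw [Polynomial.taylor_eval]; simp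
  rw [h1, h2, Polynomial.eval_eq_sum_range' (n := 2 * n + 1)]
  · rfl
  · rw [Polynomial.natDegree_taylor, Matrix.charpoly_natDegree_eq_dim]
    simp; omega

/-! ### Jordan bases -/

/-- `ξ i 1, …, ξ i (j i)` (`i : Fin m`) are Jordan chains of `M` for `μ`, of non-increasing lengths
`j i ≥ 1`, that together form a basis of the invariant space of `μ`; `ξ i 0 = 0` by convention. -/
structure IsJordanBasis {n : ℕ} (M : Matrix (Fin n ⊕ Fin n) (Fin n ⊕ Fin n) ℂ) (μ : ℂ) {m : ℕ}
    (j : Fin m → ℕ) (ξ : Fin m → ℕ → (Fin n ⊕ Fin n → ℂ)) : Prop where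
  one_le : ∀ i, 1 ≤ j i
  antitone : Antitone j
  zero : ∀ i, ξ i 0 = 0
  chain : ∀ i a, a < j i → M *ᵥ ξ i (a + 1) = μ • ξ i (a + 1) - ξ i a
  linearIndependent : LinearIndependent ℂ fun p : (i : Fin m) × Fin (j i) => ξ p.1 (p.2 + 1)
  span_eq : Submodule.span ℂ
    (Set.range fun p : (i : Fin m) × Fin (j i) => ξ p.1 (p.2 + 1)) = invSpace M μ

/-- The non-increasing sequence `j` consists of `mult 0` copies of `size 0`, followed by `mult 1`
copies of `size 1`, and so on, with `size` strictly decreasing. -/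
structure IsGrouping {m s : ℕ} (j : Fin m → ℕ) (mult size : Fin s → ℕ) : Prop where
  one_le_mult : ∀ l, 1 ≤ mult l
  one_le_size : ∀ l, 1 ≤ size l
  strictAnti : StrictAnti size
  total : m = ∑ l, mult l
  eq_size : ∀ (l : Fin s) (i : Fin m), ∑ l' ∈ Finset.Iio l, mult l' ≤ i.val →
    i.val < ∑ l' ∈ Finset.Iic l, mult l' → j i = size l

section Data

variable {n m : ℕ}

/-- `η_{i,a} = (-√-1 μ)^a ξ_{i,a}`. -/
def etaVec (μ : ℂ) (ξ : Fin m → ℕ → (Fin n ⊕ Fin n → ℂ)) (i : Fin m) (a : ℕ) :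
    Fin n ⊕ Fin n → ℂ :=
  (-Complex.I * μ) ^ a • ξ i a

/-- `S_{i,i'} = ⟨A η_{i,1}, η_{i',1}⟩`. -/
def matS (A : Matrix (Fin n ⊕ Fin n) (Fin n ⊕ Fin n) ℝ) (μ : ℂ)
    (ξ : Fin m → ℕ → (Fin n ⊕ Fin n → ℂ)) : Matrix (Fin m) (Fin m) ℂ :=
  Matrix.of fun i i' => herm (toC A *ᵥ etaVec μ ξ i 1) (etaVec μ ξ i' 1)

/-- `X_{i,i'} = (η_{i,j_i}, η_{i',1})_G`. -/
def matX (μ : ℂ) (j : Fin m → ℕ) (ξ : Fin m → ℕ → (Fin n ⊕ Fin n → ℂ)) :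
    Matrix (Fin m) (Fin m) ℂ :=
  Matrix.of fun i i' => kreinForm (etaVec μ ξ i (j i)) (etaVec μ ξ i' 1)

/-- The diagonal matrix `Λ` with entries `(-1)^{j_i - 1} (√-1 μ)^{j_i}`. -/
def matLambda (μ : ℂ) (j : Fin m → ℕ) : Matrix (Fin m) (Fin m) ℂ :=
  Matrix.diagonal fun i => (-1) ^ (j i - 1) * (Complex.I * μ) ^ j i

/-- `d = S X⁻¹ Λ`. -/
def matD (A : Matrix (Fin n ⊕ Fin n) (Fin n ⊕ Fin n) ℝ) (μ : ℂ) (j : Fin m → ℕ)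
    (ξ : Fin m → ℕ → (Fin n ⊕ Fin n → ℂ)) : Matrix (Fin m) (Fin m) ℂ :=
  matS A μ ξ * (matX μ j ξ)⁻¹ * matLambda μ j

/-- The principal minor of `d` with rows and columns in `I`. -/
def principalMinor (d : Matrix (Fin m) (Fin m) ℂ) (I : Finset (Fin m)) : ℂ :=
  (d.submatrix (fun i : I => (i : Fin m)) (fun i : I => (i : Fin m))).det

/-! In the next definitions a position `i : Fin m` stands for the (1-based) block number `i + 1`. -/

/-- The first `r` blocks. -/
def firstBlocks (m r : ℕ) : Finset (Fin m) := Finset.univ.filter fun i => i.val < r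

/-- The total size of the first `r` blocks. -/
def headSize (j : Fin m → ℕ) (r : ℕ) : ℕ := ∑ i ∈ firstBlocks m r, j i

/-- The total size of all blocks but the first `r`. -/
def tailSize (j : Fin m → ℕ) (r : ℕ) : ℕ := ∑ i ∈ (firstBlocks m r)ᶜ, j i

/-- `φ(k)`: the least `r ∈ {1, …, m}` such that the `r` biggest blocks have total size at least
`N - k`, where `N` is the sum of all sizes. -/
def phi (j : Fin m → ℕ) (k : ℕ) : ℕ :=
  sInf {r : ℕ | 1 ≤ r ∧ r ≤ m ∧ ∑ i, j i ≤ headSize j r + k}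

/-- The sets `I` of `φ(k)` blocks such that all blocks in `I` are at least as big, and all blocks
outside `I` at most as big, as the block number `φ(k)`. -/
def biggestBlockSets (j : Fin m → ℕ) (k : ℕ) : Finset (Finset (Fin m)) :=
  open Classical in
  Finset.univ.filter fun I => I.card = phi j k ∧
    ∀ r : Fin m, r.val + 1 = phi j k → (∀ i ∈ I, j r ≤ j i) ∧ (∀ i ∉ I, j i ≤ j r)

end Data

end SymplecticPath

end

/-! Extend the Jordan chains to a basis of `ℂ²ⁿ`, and let `P` be the matrix of `λ₀ - γ(0)` in it.
Writing `γ(t) = γ(0) + t s(t)` with `s` continuous at `0` and `s(0) = γ'(0)`, the coefficient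
`c_k(t)` is the sum over `r` of `(-t)^r mixedDet k r P (s(t))`, where `mixedDet k r P D` is the
coefficient of `z^k w^r` in `det(z + P + wD)`. It remains to decide which of these coefficients
vanish for every `D`, and to compute the first one that need not. Along a chain `v_0, v_1, ...` the
matrix `P` is a nilpotent shift, so `z + P` sends the sum of the `(-z)^a v_a` to `± z^(j_i)` times
the last vector. Column operations that are trivial at `z = 0` therefore extract a factor `z^(j_i)`
from the column at the head of each chain. Taking `r` columns from `D` destroys at most `r` of these
factors, and the cheapest choice is to hit the heads of the `r` longest chains. Hence `mixedDet k r
P D = 0` when `k < tailSize j r`, which makes `φ(k)` the first relevant power of `t`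
(`mixedDet_eq_zero_of_lt_tailSize`). If `k = tailSize j (φ k)`, only the optimal choices, indexed by
`biggestBlockSets`, contribute. What is left at `z = 0` is `closedShift`, in which the chains are
closed up by signed end vectors; its determinant is `c_N(0) ≠ 0`. By Cramer's rule each contribution
is `c_N(0)` times a principal minor of `Y = C⁻¹ D` on the chain heads, with `C = closedShift` and
`D` the matrix of `γ'(0)` (`mixedDet_phi_eq_sum_minors`). The Krein form identifies these minors:
since `|λ₀| = 1`, pairing with `η_{i',1}` kills the range of `λ₀ - γ(0)`. Applied to `CY = D`, this
gives `S = Yᵀ · diagonal · X`, so `d` is `Yᵀ` on the heads up to column signs (`matD_apply`). -/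

namespace SymplecticPath

/-! ### Two-parameter expansion of determinants, and extraction of column factors. -/

section MixedDeterminant

open Polynomial

variable {ι R : Type*} [Fintype ι] [DecidableEq ι] [CommRing R]

/-- The matrix whose column `c` is taken from `1`, `P` or `D`, according to `σ c`. -/
def selectMatrix (P D : Matrix ι ι R) (σ : ι → Fin 3) : Matrix ι ι R :=
  Matrix.of fun a c => if σ c = 1 then P a c else if σ c = 2 then D a c else (1 : Matrix ι ι R) a c

/-- The number of positions where `σ` takes the value `x`. -/
def valueCount (σ : ι → Fin 3) (x : Fin 3) : ℕ := (Finset.univ.filter fun c => σ c = x).card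

/-- The coefficient of `z ^ k * w ^ r` in `det (z • 1 + P + w • D)`. -/
def mixedDet (k r : ℕ) (P D : Matrix ι ι R) : R :=
  ∑ σ : ι → Fin 3 with valueCount σ 0 = k ∧ valueCount σ 2 = r, (selectMatrix P D σ).det

/-- The matrix whose column `c` is taken from `D` if `c ∈ S` and from `Q` otherwise. -/
def mixColumns (Q D : Matrix ι ι R) (S : Finset ι) : Matrix ι ι R :=
  Matrix.of fun a c => if c ∈ S then D a c else Q a c

/-- The coefficient of `w ^ r` in `det (Q + w • D)`. -/
def columnSum (r : ℕ) (Q D : Matrix ι ι R) : R :=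
  ∑ S ∈ Finset.powersetCard r Finset.univ, (mixColumns Q D S).det

omit [DecidableEq ι] in
theorem valueCount_add (σ : ι → Fin 3) :
    valueCount σ 0 + valueCount σ 1 + valueCount σ 2 = Fintype.card ι := by
  have := Finset.card_eq_sum_card_fiberwise (s := (Finset.univ : Finset ι)) (f := σ)
    (t := Finset.univ) (by simp)
  rw [Fin.sum_univ_three, Finset.card_univ] at this
  exact this.symm

theorem det_smul_one_add_add_smul (P D : Matrix ι ι R) (z w : R) :
    (z • (1 : Matrix ι ι R) + P + w • D).det =
      ∑ σ : ι → Fin 3, z ^ valueCount σ 0 * w ^ valueCount σ 2 * (selectMatrix P D σ).det := by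
  have h := (Matrix.detRowAlternating (n := ι) (R := R)).toMultilinearMap.map_sum
    (fun (c : ι) (x : Fin 3) => (![z, 1, w] x) •
      (fun a => if x = 1 then P a c else if x = 2 then D a c else (1 : Matrix ι ι R) a c))
  have e : (fun c => ∑ x : Fin 3, (![z, 1, w] x) •
      (fun a => if x = 1 then P a c else if x = 2 then D a c else (1 : Matrix ι ι R) a c))
      = (z • (1 : Matrix ι ι R) + P + w • D)ᵀ := by
    funext c a
    simp [Fin.sum_univ_three]
  rw [e] at h
  rw [← Matrix.det_transpose]
  refine h.trans (Finset.sum_congr rfl fun σ _ => ?_)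
  rw [MultilinearMap.map_smul_univ, smul_eq_mul]
  congr 1
  · rw [← Finset.prod_fiberwise_of_maps_to (t := Finset.univ) (g := σ) (by simp),
      Fin.prod_univ_three]
    have key : ∀ x : Fin 3, ∏ i with σ i = x, (![z, 1, w] (σ i)) = (![z, 1, w] x) ^ valueCount σ x := by
      intro x
      rw [valueCount, ← Finset.prod_const]
      refine Finset.prod_congr rfl fun i hi => ?_
      rw [(Finset.mem_filter.1 hi).2]
    rw [key, key, key]
    simp
  · rw [← Matrix.det_transpose]
    rfl

theorem det_add_smul (Q D : Matrix ι ι R) (w : R) :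
    (Q + w • D).det = ∑ S : Finset ι, w ^ S.card * (mixColumns Q D S).det := by
  have h := (Matrix.detRowAlternating (n := ι) (R := R)).toMultilinearMap.map_add_univ
    (fun c a => w * D a c) (fun c a => Q a c)
  have e : (fun c a => w * D a c) + (fun c a => Q a c) = (Q + w • D)ᵀ := by
    funext c a
    simp [add_comm]
  rw [e] at h
  rw [← Matrix.det_transpose]
  refine h.trans (Finset.sum_congr rfl fun S _ => ?_)
  have e2 : S.piecewise (fun c a => w * D a c) (fun c a => Q a c) =
      fun c => (if c ∈ S then w else 1) • fun a => mixColumns Q D S a c := by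
    funext c a
    by_cases hc : c ∈ S <;> simp [hc, mixColumns]
  rw [e2, MultilinearMap.map_smul_univ, smul_eq_mul, Finset.prod_ite_mem]
  simp only [Finset.univ_inter, Finset.prod_const]
  congr 1
  rw [← Matrix.det_transpose (mixColumns Q D S)]
  rfl

omit [Fintype ι] in
theorem map_selectMatrix {S : Type*} [CommRing S] (f : R →+* S) (P D : Matrix ι ι R)
    (σ : ι → Fin 3) : (selectMatrix P D σ).map f = selectMatrix (P.map f) (D.map f) σ := by
  ext a c
  simp only [selectMatrix, Matrix.map_apply, Matrix.of_apply, Matrix.one_apply]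
  split_ifs <;> simp

omit [Fintype ι] in
theorem map_mixColumns {S : Type*} [CommRing S] (f : R →+* S) (Q D : Matrix ι ι R)
    (s : Finset ι) : (mixColumns Q D s).map f = mixColumns (Q.map f) (D.map f) s := by
  ext a c
  simp only [mixColumns, Matrix.map_apply, Matrix.of_apply]
  split_ifs <;> simp

theorem coeff_det_add_X_smul (r : ℕ) (Q D : Matrix ι ι R) :
    ((Q.map C + (X : R[X]) • D.map C).det).coeff r = columnSum r Q D := by
  have h : ∀ S : Finset ι, (X : R[X]) ^ S.card * (mixColumns (Q.map C) (D.map C) S).det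
      = C (mixColumns Q D S).det * X ^ S.card := fun S => by
    rw [← map_mixColumns, RingHom.map_det C, RingHom.mapMatrix_apply, mul_comm]
  simp only [det_add_smul, finsetSum_coeff, h, coeff_C_mul_X_pow, columnSum]
  rw [← Finset.sum_filter]
  refine Finset.sum_congr ?_ fun _ _ => rfl
  ext S
  simp [Finset.mem_powersetCard, eq_comm]

/-- The individual `mixColumns` determinants do not factor through `T`; their sum does, because it
is a coefficient of `det ((Q + wD) T)`. -/
theorem columnSum_mul (r : ℕ) (Q D T : Matrix ι ι R) :
    columnSum r (Q * T) (D * T) = columnSum r Q D * T.det := by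
  rw [← coeff_det_add_X_smul, ← coeff_det_add_X_smul, ← coeff_mul_C, RingHom.map_det,
    RingHom.mapMatrix_apply, ← Matrix.det_mul]
  congr 2
  rw [Matrix.map_mul, Matrix.map_mul, Matrix.add_mul, Matrix.smul_mul]

/-- In `R[X][X]` the outer variable plays `w` and the inner one `z`. This allows `z` to be treated
as a parameter while columns are operated on. -/
theorem coeff_columnSum (k r : ℕ) (P D : Matrix ι ι R) :
    (columnSum r ((X : R[X]) • (1 : Matrix ι ι R[X]) + P.map C) (D.map C)).coeff k
      = mixedDet k r P D := by
  rw [← coeff_det_add_X_smul]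
  have e : ((X : R[X]) • (1 : Matrix ι ι R[X]) + P.map C).map C
      = (C (X : R[X])) • (1 : Matrix ι ι R[X][X]) + (P.map C).map C := by
    ext a c
    by_cases h : a = c <;> simp [h]
  have h : ∀ σ : ι → Fin 3, (C (X : R[X])) ^ valueCount σ 0 * (X : R[X][X]) ^ valueCount σ 2 *
      (selectMatrix ((P.map C).map C) ((D.map C).map C) σ).det
      = C (C (selectMatrix P D σ).det * X ^ valueCount σ 0) * X ^ valueCount σ 2 := fun σ => by
    rw [← map_selectMatrix, ← RingHom.mapMatrix_apply, ← RingHom.map_det, ← map_selectMatrix,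
      ← RingHom.mapMatrix_apply, ← RingHom.map_det, C_mul, C_pow]
    ring
  rw [e, det_smul_one_add_add_smul]
  simp only [finsetSum_coeff, h, coeff_C_mul_X_pow, mixedDet]
  rw [Finset.sum_filter]
  refine Finset.sum_congr rfl fun σ _ => ?_
  by_cases h2 : valueCount σ 2 = r
  · by_cases h0 : valueCount σ 0 = k
    · simp [h0, h2]
    · simp [h0, h2, Ne.symm h0, coeff_X_pow]
  · simp [h2, Ne.symm h2]

theorem coeff_det_X_smul_add (k : ℕ) (P D : Matrix ι ι R) (w : R) :
    (((X : R[X]) • (1 : Matrix ι ι R[X]) + (P + w • D).map C).det).coeff k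
      = ∑ r ∈ Finset.range (Fintype.card ι + 1), w ^ r * mixedDet k r P D := by
  have e : (X : R[X]) • (1 : Matrix ι ι R[X]) + (P + w • D).map C
      = (X : R[X]) • (1 : Matrix ι ι R[X]) + P.map C + C w • D.map C := by
    ext a c
    simp [add_assoc]
  have h : ∀ σ : ι → Fin 3, (X : R[X]) ^ valueCount σ 0 * (C w) ^ valueCount σ 2 *
      (selectMatrix (P.map C) (D.map C) σ).det
      = C (w ^ valueCount σ 2 * (selectMatrix P D σ).det) * X ^ valueCount σ 0 := fun σ => by
    rw [← map_selectMatrix, ← RingHom.mapMatrix_apply, ← RingHom.map_det, C_mul, C_pow]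
    ring
  rw [e, det_smul_one_add_add_smul]
  simp only [finsetSum_coeff, h, coeff_C_mul_X_pow, mixedDet, Finset.mul_sum]
  rw [← Finset.sum_filter]
  simp only [eq_comm (a := k)]
  rw [← Finset.sum_fiberwise_of_maps_to (t := Finset.range (Fintype.card ι + 1))
    (g := fun σ => valueCount σ 2)]
  · refine Finset.sum_congr rfl fun r _ => ?_
    rw [Finset.filter_filter]
    refine Finset.sum_congr rfl fun σ hσ => ?_
    rw [(Finset.mem_filter.1 hσ).2.2]
  · intro σ _
    have := valueCount_add σ
    simp only [Finset.mem_range]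
    omega

/-- The bound `hkr` makes the truncated subtraction exact, so prescribing the counts of `1` and `2`
is the same as prescribing those of `0` and `2`. -/
theorem mixedWedgeScalar_eq_mixedDet {K V : Type*} [Field K] [AddCommGroup V] [Module K V]
    [FiniteDimensional K V] {d k r : ℕ} (b : Module.Basis (Fin d) K V) (hkr : k + r ≤ d)
    (A₁ A₂ : V →ₗ[K] V) :
    mixedWedgeScalar d (d - k - r) r A₁ A₂ =
      mixedDet k r (LinearMap.toMatrix b b A₁) (LinearMap.toMatrix b b A₂) := by
  have hd : Module.finrank K V = d := by simp [Module.finrank_eq_card_basis b]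
  have h := mixedWedge_eq_smul hd (d - k - r) r A₁ A₂ (exteriorPower.ιMulti K d b)
  rw [mixedWedge_ιMulti] at h
  -- The form `b.det` takes the value `1` on the basis itself, so it reads off the scalar.
  have h' := congrArg (exteriorPower.alternatingMapLinearEquiv b.det) h
  rw [map_sum, map_smul] at h'
  simp only [exteriorPower.alternatingMapLinearEquiv_apply_ιMulti, Module.Basis.det_self,
    smul_eq_mul, mul_one] at h'
  rw [← h', mixedDet]
  refine Finset.sum_congr ?_ fun σ _ => ?_
  · ext σ
    have := valueCount_add σ
    rw [Fintype.card_fin] at this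
    simp only [assignments, Finset.mem_filter, Finset.mem_univ, true_and]
    change valueCount σ 1 = _ ∧ valueCount σ 2 = _ ↔ _
    omega
  · rw [Module.Basis.det_apply]
    congr 1
    ext a c
    simp only [selectMatrix, chooseMap, Module.Basis.toMatrix_apply, Matrix.of_apply,
      LinearMap.toMatrix_apply]
    split_ifs
    · rfl
    · rfl
    · simp [Matrix.one_apply, Finsupp.single_apply, eq_comm]

/-- If `(X + P) T` is, up to factors `X ^ wt c` of its columns, a polynomial matrix `Q`, then the
order of `columnSum r (X + P) D` at `0` and its leading coefficient can be read off from `Q`. -/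
theorem mixedDet_eq_sum_of_factor {K : Type*} [Field K] (P D : Matrix ι ι K)
    (T Q : Matrix ι ι K[X]) (wt : ι → ℕ) (hT : T.map (eval 0) = 1)
    (hQ : ((X : K[X]) • (1 : Matrix ι ι K[X]) + P.map C) * T
      = Q * Matrix.diagonal fun c => X ^ wt c)
    (k r : ℕ) (hk : ∀ S : Finset ι, S.card = r → k ≤ ∑ c ∈ Sᶜ, wt c) :
    mixedDet k r P D = ∑ S ∈ Finset.powersetCard r Finset.univ with ∑ c ∈ Sᶜ, wt c = k,
      (mixColumns (Q.map (eval 0)) D S).det := by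
  set F := columnSum r ((X : K[X]) • (1 : Matrix ι ι K[X]) + P.map C) (D.map C) with hF
  have hdet : ∀ S : Finset ι, (mixColumns (Q * Matrix.diagonal fun c => X ^ wt c)
      (D.map C * T) S).det = X ^ (∑ c ∈ Sᶜ, wt c) * (mixColumns Q (D.map C * T) S).det := by
    intro S
    have : mixColumns (Q * Matrix.diagonal fun c => X ^ wt c) (D.map C * T) S
        = mixColumns Q (D.map C * T) S *
          Matrix.diagonal fun c => if c ∈ S then 1 else X ^ wt c := by
      ext1 a c
      rw [Matrix.mul_diagonal]
      simp only [mixColumns, Matrix.of_apply, Matrix.mul_diagonal]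
      split_ifs <;> simp
    rw [this, Matrix.det_mul, Matrix.det_diagonal, mul_comm, Finset.prod_ite]
    congr 1
    rw [Finset.prod_const_one, one_mul, Finset.prod_pow_eq_pow_sum]
    congr 2
    ext c
    simp
  have h1 : F * T.det = X ^ k * ∑ S ∈ Finset.powersetCard r Finset.univ,
      X ^ (∑ c ∈ Sᶜ, wt c - k) * (mixColumns Q (D.map C * T) S).det := by
    rw [hF, ← columnSum_mul, hQ, columnSum, Finset.mul_sum]
    refine Finset.sum_congr rfl fun S hS => ?_
    rw [hdet, ← mul_assoc, ← pow_add,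
      Nat.add_sub_cancel' (hk S (Finset.mem_powersetCard.1 hS).2)]
  have hT0 : eval 0 T.det = 1 := by
    have : eval 0 T.det = (T.map (eval 0)).det := by
      rw [← coe_evalRingHom, RingHom.map_det, RingHom.mapMatrix_apply]
    rw [this, hT, Matrix.det_one]
  -- `T.det` has constant term `1`, so the divisibility of `F * T.det` by `X ^ k` passes to `F`.
  have hcop : IsCoprime ((X : K[X]) ^ k) T.det := by
    refine IsCoprime.pow_left ((irreducible_X.coprime_iff_not_dvd).2 fun hd => ?_)
    rw [X_dvd_iff, coeff_zero_eq_eval_zero, hT0] at hd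
    exact one_ne_zero hd
  obtain ⟨G, hG⟩ : (X : K[X]) ^ k ∣ F :=
    hcop.dvd_of_dvd_mul_right (Dvd.intro _ h1.symm)
  rw [hG, mul_assoc] at h1
  -- After cancelling `X ^ k`, evaluation at `0` keeps exactly the sets whose complement has weight
  -- `k`.
  have h2 := congrArg (eval 0) (mul_left_cancel₀ (pow_ne_zero k X_ne_zero) h1)
  rw [eval_mul, hT0, mul_one, eval_finsetSum] at h2
  rw [← coeff_columnSum, ← hF, hG, coeff_X_pow_mul', if_pos le_rfl, Nat.sub_self,
    coeff_zero_eq_eval_zero, h2, Finset.sum_filter]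
  refine Finset.sum_congr rfl fun S hS => ?_
  have hle := hk S (Finset.mem_powersetCard.1 hS).2
  rw [eval_mul, eval_pow, eval_X]
  split_ifs with h
  · rw [h, Nat.sub_self, pow_zero, one_mul, ← coe_evalRingHom, RingHom.map_det,
      RingHom.mapMatrix_apply, map_mixColumns, coe_evalRingHom]
    congr 2
    rw [← coe_evalRingHom, Matrix.map_mul, coe_evalRingHom, hT, mul_one, Matrix.map_map]
    ext a c
    simp
  · rw [zero_pow (by omega), zero_mul]

/-- Columns outside `S` are unit vectors, so the matrix is block triangular with an identity block.
-/
theorem det_mixColumns_one {R : Type*} [CommRing R] (Y : Matrix ι ι R) (S : Finset ι) :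
    (mixColumns 1 Y S).det
      = (Y.submatrix (fun i : S => (i : ι)) (fun i : S => (i : ι))).det := by
  rw [← Matrix.det_transpose, Matrix.twoBlockTriangular_det _ (fun c => c ∈ S)]
  · have e1 : (mixColumns 1 Y S)ᵀ.toSquareBlockProp (fun c => c ∈ S)
        = (Y.submatrix (fun i : S => (i : ι)) (fun i : S => (i : ι)))ᵀ := by
      ext a c
      simp [Matrix.toSquareBlockProp, mixColumns]
    have e2 : (mixColumns 1 Y S)ᵀ.toSquareBlockProp (fun c => ¬ c ∈ S) = 1 := by
      ext a c
      simp [Matrix.toSquareBlockProp, mixColumns, Matrix.one_apply, a.2, Subtype.ext_iff, eq_comm]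
    rw [e1, e2, Matrix.det_one, mul_one, ← Matrix.det_transpose (Y.submatrix _ _)]
    congr!
  · intro a ha c hc
    have : c ≠ a := fun h => ha (h ▸ hc)
    simp [mixColumns, ha, this]

/-- Cramer's rule for several columns: `mixColumns Q D S = Q * mixColumns 1 Y S`. -/
theorem det_mixColumns {R : Type*} [CommRing R] (Q Y D : Matrix ι ι R) (h : Q * Y = D)
    (S : Finset ι) : (mixColumns Q D S).det
      = Q.det * (Y.submatrix (fun i : S => (i : ι)) (fun i : S => (i : ι))).det := by
  rw [← det_mixColumns_one, ← Matrix.det_mul]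
  congr 1
  ext a c
  by_cases hc : c ∈ S
  · simp [mixColumns, hc, ← h, Matrix.mul_apply]
  · simp [mixColumns, hc, Matrix.mul_apply, Matrix.one_apply]

end MixedDeterminant

/-! ### Positions of the first and last vectors of the chains. -/

section ChainHeads

variable {ι : Type*} {m : ℕ} {j : Fin m → ℕ}
variable (hj : ∀ i, 1 ≤ j i) (e : ((i : Fin m) × Fin (j i)) → ι)

/-- The position of the first vector of the `i`-th chain. -/
def chainHead (i : Fin m) : ι := e ⟨i, ⟨0, hj i⟩⟩

/-- The position of the last vector of the `i`-th chain. -/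
def chainLast (i : Fin m) : ι := e ⟨i, ⟨j i - 1, Nat.sub_lt (hj i) Nat.one_pos⟩⟩

open Classical in
/-- The matrix obtained from `Q` by replacing its column at the head of each chain. -/
noncomputable def replaceHeads {R : Type*} (Q : Matrix ι ι R) (v : Fin m → ι → R) : Matrix ι ι R :=
  Matrix.of fun a c => if h : ∃ i, chainHead hj e i = c then v h.choose a else Q a c

variable {e}

theorem chainHead_injective (he : Function.Injective e) :
    Function.Injective (chainHead hj e) := by
  intro i i' h
  exact congrArg Sigma.fst (he h)

theorem replaceHeads_head (he : Function.Injective e) {R : Type*} (Q : Matrix ι ι R)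
    (v : Fin m → ι → R) (i : Fin m) (a : ι) :
    replaceHeads hj e Q v a (chainHead hj e i) = v i a := by
  have h : ∃ i', chainHead hj e i' = chainHead hj e i := ⟨i, rfl⟩
  simp only [replaceHeads, Matrix.of_apply, h, dif_pos]
  rw [chainHead_injective hj he h.choose_spec]

theorem replaceHeads_of_notMem {R : Type*} (Q : Matrix ι ι R)
    (v : Fin m → ι → R) (a c : ι) (hc : ∀ i, chainHead hj e i ≠ c) :
    replaceHeads hj e Q v a c = Q a c := by
  simp [replaceHeads, hc]

open Classical in
/-- The length of the chain headed by the position `c`, or `0`. -/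
noncomputable def headLength (e : ((i : Fin m) × Fin (j i)) → ι) (c : ι) : ℕ :=
  if h : ∃ i, chainHead hj e i = c then j h.choose else 0

theorem headLength_head (he : Function.Injective e) (i : Fin m) :
    headLength hj e (chainHead hj e i) = j i := by
  have h : ∃ i', chainHead hj e i' = chainHead hj e i := ⟨i, rfl⟩
  simp only [headLength, h, dif_pos]
  rw [chainHead_injective hj he h.choose_spec]

theorem headLength_of_notMem (c : ι) (hc : ∀ i, chainHead hj e i ≠ c) :
    headLength hj e c = 0 := by
  simp [headLength, hc]

end ChainHeads

/-! ### Factoring `X ^ j i` out of the head columns of `X + P`. -/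

section JordanColumns

open Polynomial

variable {ι K : Type*} [Fintype ι] [DecidableEq ι] [Field K] {m : ℕ} {j : Fin m → ℕ}

/-- The unit vector at the position of the `(a + 1)`-st vector of the `i`-th chain, or `0` if the
chain is shorter. -/
def chainVec (R : Type*) [CommRing R] (e : ((i : Fin m) × Fin (j i)) → ι) (i : Fin m) (a : ℕ) :
    ι → R :=
  if h : a < j i then Pi.single (e ⟨i, ⟨a, h⟩⟩) 1 else 0

/-- `P` acts on the unit vectors in the range of `e` as a nilpotent shift along the chains. -/
def IsShift (P : Matrix ι ι K) (e : ((i : Fin m) × Fin (j i)) → ι) : Prop :=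
  ∀ i a, a < j i → P *ᵥ chainVec K e i a = if a = 0 then 0 else chainVec K e i (a - 1)

theorem map_C_mulVec_chainVec (P : Matrix ι ι K) (e : ((i : Fin m) × Fin (j i)) → ι)
    (i : Fin m) (a : ℕ) :
    P.map C *ᵥ chainVec K[X] e i a = fun x => C ((P *ᵥ chainVec K e i a) x) := by
  funext x
  unfold chainVec
  split_ifs with h
  · simp
  · simp

/-- The sum telescopes: the shift part of each term cancels the `X` part of the preceding one. -/
theorem shift_mulVec_alternating_sum {P : Matrix ι ι K} {e : ((i : Fin m) × Fin (j i)) → ι}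
    (hP : IsShift P e) (i : Fin m) (b : ℕ) (hb : b < j i) :
    ((X : K[X]) • (1 : Matrix ι ι K[X]) + P.map C) *ᵥ
        (∑ a ∈ Finset.range (b + 1), (-X : K[X]) ^ a • chainVec K[X] e i a)
      = (-(-X : K[X]) ^ (b + 1)) • chainVec K[X] e i b := by
  have hC : ∀ a, a < j i → (fun x => C (chainVec K e i a x)) = chainVec K[X] e i a := by
    intro a ha
    funext x
    simp only [chainVec, ha, dif_pos, Pi.single_apply]
    split_ifs <;> simp
  have hstep : ∀ a, a < j i → ((X : K[X]) • (1 : Matrix ι ι K[X]) + P.map C) *ᵥ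
      chainVec K[X] e i a = (X : K[X]) • chainVec K[X] e i a +
        if a = 0 then 0 else chainVec K[X] e i (a - 1) := by
    intro a ha
    rw [Matrix.add_mulVec, Matrix.smul_mulVec, Matrix.one_mulVec, map_C_mulVec_chainVec,
      hP i a ha]
    congr 1
    split_ifs with h0
    · funext x; simp
    · exact hC _ (by omega)
  induction b with
  | zero => simp [hstep 0 hb]
  | succ b ih =>
    rw [Finset.sum_range_succ, Matrix.mulVec_add, ih (by omega), Matrix.mulVec_smul,
      hstep _ hb, if_neg (by omega), Nat.add_sub_cancel]
    module

variable (hj : ∀ i, 1 ≤ j i) {e : ((i : Fin m) × Fin (j i)) → ι}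

/-- `P` with the (zero) columns at the heads of the chains replaced by signed unit vectors at the
ends of the chains. -/
noncomputable def closedShift (P : Matrix ι ι K) (e : ((i : Fin m) × Fin (j i)) → ι) : Matrix ι ι K :=
  replaceHeads hj e P fun i => (-(-1 : K) ^ j i) • Pi.single (chainLast hj e i) 1

theorem mixedDet_eq_sum_closedShift (he : Function.Injective e) {P : Matrix ι ι K}
    (hP : IsShift P e) (D : Matrix ι ι K) (k r : ℕ)
    (hk : ∀ S : Finset ι, S.card = r → k ≤ ∑ c ∈ Sᶜ, headLength hj e c) :
    mixedDet k r P D =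
      ∑ S ∈ Finset.powersetCard r Finset.univ with ∑ c ∈ Sᶜ, headLength hj e c = k,
        (mixColumns (closedShift hj P e) D S).det := by
  -- `T` performs the column operations that produce the telescoping sums at the heads; `Q` is what
  -- remains of `(X + P) T` once the powers `X ^ j i` are removed.
  set T : Matrix ι ι K[X] := replaceHeads hj e 1 fun i =>
    ∑ a ∈ Finset.range (j i - 1 + 1), (-X : K[X]) ^ a • chainVec K[X] e i a with hTdef
  set Q : Matrix ι ι K[X] := replaceHeads hj e ((X : K[X]) • (1 : Matrix ι ι K[X]) + P.map C)
    fun i => (-(-1 : K[X]) ^ j i) • Pi.single (chainLast hj e i) 1 with hQdef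
  have hQ0 : Q.map (eval 0) = closedShift hj P e := by
    ext a c
    rw [Matrix.map_apply, closedShift]
    by_cases hc : ∃ i, chainHead hj e i = c
    · obtain ⟨i, rfl⟩ := hc
      rw [hQdef, replaceHeads_head hj he, replaceHeads_head hj he]
      simp [Pi.single_apply]
      split_ifs <;> simp
    · rw [hQdef, replaceHeads_of_notMem hj _ _ _ _ (not_exists.1 hc),
        replaceHeads_of_notMem hj _ _ _ _ (not_exists.1 hc)]
      simp
  rw [← hQ0]
  refine mixedDet_eq_sum_of_factor P D T Q (headLength hj e) ?_ ?_ k r hk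
  · ext a c
    rw [Matrix.map_apply]
    by_cases hc : ∃ i, chainHead hj e i = c
    · obtain ⟨i, rfl⟩ := hc
      rw [hTdef, replaceHeads_head hj he, Finset.sum_range_succ']
      have h0 : 0 < j i := hj i
      have : Pi.single (M := fun _ => K[X]) (chainHead hj e i) 1 a
        = C ((1 : Matrix ι ι K) a (chainHead hj e i)) := by
        simp only [Pi.single_apply, Matrix.one_apply]
        split_ifs <;> simp
      rw [← coe_evalRingHom]
      simp only [Pi.add_apply, Finset.sum_apply, Pi.smul_apply, smul_eq_mul, map_add, map_sum,
        map_mul, map_pow, coe_evalRingHom, eval_neg, eval_X]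
      simp only [neg_zero, ne_eq, Nat.add_eq_zero_iff, one_ne_zero, and_false, not_false_eq_true,
        zero_pow, zero_mul, Finset.sum_const_zero, zero_add, pow_zero, one_mul]
      rw [chainVec, dif_pos h0]
      change eval 0 (Pi.single (M := fun _ => K[X]) (chainHead hj e i) 1 a) = _
      rw [this, eval_C]
    · rw [hTdef, replaceHeads_of_notMem hj _ _ _ _ (not_exists.1 hc), Matrix.one_apply,
        Matrix.one_apply]
      split_ifs <;> simp
  · ext1 a c
    rw [Matrix.mul_diagonal]
    by_cases hc : ∃ i, chainHead hj e i = c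
    · obtain ⟨i, rfl⟩ := hc
      have hcol : (fun x => T x (chainHead hj e i)) =
          ∑ a ∈ Finset.range (j i - 1 + 1), (-X : K[X]) ^ a • chainVec K[X] e i a := by
        funext x
        rw [hTdef, replaceHeads_head hj he]
      have h1 := congrFun (shift_mulVec_alternating_sum hP i (j i - 1)
        (Nat.sub_lt (hj i) Nat.one_pos)) a
      rw [← hcol, Nat.sub_add_cancel (hj i)] at h1
      have h2 : chainVec K[X] e i (j i - 1) = Pi.single (chainLast hj e i) 1 := by
        rw [chainVec, dif_pos (Nat.sub_lt (hj i) Nat.one_pos)]; rfl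
      rw [headLength_head hj he, hQdef, replaceHeads_head hj he]
      refine h1.trans ?_
      rw [h2, neg_pow (X : K[X])]
      simp only [Pi.smul_apply, smul_eq_mul]
      ring
    · have hcol : (fun x => T x c) = Pi.single c 1 := by
        funext x
        rw [hTdef, replaceHeads_of_notMem hj _ _ _ _ (not_exists.1 hc), Matrix.one_apply,
          Pi.single_apply]
      rw [headLength_of_notMem hj _ (not_exists.1 hc), hQdef,
        replaceHeads_of_notMem hj _ _ _ _ (not_exists.1 hc), pow_zero, mul_one]
      change (((X : K[X]) • (1 : Matrix ι ι K[X]) + P.map C) *ᵥ fun x => T x c) a = _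
      rw [hcol, Matrix.mulVec_single_one]
      rfl

/-- The weight of the complement of `S`, as a sum over chains. -/
theorem sum_headLength_compl (he : Function.Injective e) (S : Finset ι) :
    ∑ c ∈ Sᶜ, headLength hj e c = ∑ i with chainHead hj e i ∉ S, j i := by
  symm
  refine Finset.sum_of_injOn (chainHead hj e) (chainHead_injective hj he).injOn ?_ ?_ ?_
  · intro i hi
    simpa using hi
  · intro c hc hc'
    refine headLength_of_notMem hj c fun i hi => hc' ⟨i, ?_, hi⟩
    subst hi
    simpa using hc
  · intro i _
    exact (headLength_head hj he i).symm

end JordanColumns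

/-! ### Combinatorics of block sizes and of `phi`. -/

section BlockSizes

variable {m : ℕ} {j : Fin m → ℕ}

theorem headSize_add_tailSize (j : Fin m → ℕ) (r : ℕ) :
    headSize j r + tailSize j r = ∑ i, j i :=
  Finset.sum_add_sum_compl _ _

theorem card_firstBlocks {r : ℕ} (hr : r ≤ m) : (firstBlocks m r).card = r := by
  rw [firstBlocks, Fin.card_filter_val_lt, min_eq_right hr]

theorem tailSize_strictAntiOn (hj : ∀ i, 1 ≤ j i) {r r' : ℕ} (h : r < r') (hr' : r' ≤ m) :
    tailSize j r' < tailSize j r := by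
  refine Finset.sum_lt_sum_of_subset (i := ⟨r, by omega⟩) ?_ ?_ ?_ (hj _) fun _ _ _ => Nat.zero_le _
  · intro i
    simp only [firstBlocks, Finset.mem_compl, Finset.mem_filter, Finset.mem_univ, true_and]
    omega
  · simp [firstBlocks]
  · simp [firstBlocks, h]

theorem tailSize_eq_iff (hj : ∀ i, 1 ≤ j i) {r r' : ℕ} (hr : r ≤ m) (hr' : r' ≤ m) :
    tailSize j r = tailSize j r' ↔ r = r' := by
  refine ⟨fun h => ?_, fun h => h ▸ rfl⟩
  rcases lt_trichotomy r r' with h1 | h1 | h1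
  · have := tailSize_strictAntiOn hj h1 hr'; omega
  · exact h1
  · have := tailSize_strictAntiOn hj h1 hr; omega

theorem tailSize_card (j : Fin m → ℕ) : tailSize j m = 0 := by
  have : firstBlocks m m = Finset.univ := by simp [firstBlocks]
  simp [tailSize, this]

theorem isLeast_phi_headSize {k : ℕ} (hk : k < ∑ i, j i) :
    IsLeast {r : ℕ | 1 ≤ r ∧ r ≤ m ∧ ∑ i, j i ≤ headSize j r + k} (phi j k) := by
  have hm : 1 ≤ m := by
    rcases Nat.eq_zero_or_pos m with rfl | h
    · simp at hk
    · exact h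
  have hne : {r : ℕ | 1 ≤ r ∧ r ≤ m ∧ ∑ i, j i ≤ headSize j r + k}.Nonempty := by
    refine ⟨m, hm, le_rfl, ?_⟩
    have := headSize_add_tailSize j m
    rw [tailSize_card] at this
    omega
  exact ⟨Nat.sInf_mem hne, fun r hr => Nat.sInf_le hr⟩

theorem isLeast_phi {k : ℕ} (hk : k < ∑ i, j i) :
    IsLeast {r : ℕ | 1 ≤ r ∧ r ≤ m ∧ tailSize j r ≤ k} (phi j k) := by
  convert isLeast_phi_headSize hk using 5 with r
  have := headSize_add_tailSize j r
  omega

theorem lt_tailSize_of_lt_phi {k r : ℕ} (hk : k < ∑ i, j i) (hr : r < phi j k) :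
    k < tailSize j r := by
  have h := isLeast_phi hk
  by_contra! hle
  rcases Nat.eq_zero_or_pos r with rfl | hpos
  · have : tailSize j 0 = ∑ i, j i := by simp [tailSize, firstBlocks]
    omega
  · have := h.2 ⟨hpos, by have := h.1.2.1; omega, hle⟩
    omega

theorem add_phi_le (hj : ∀ i, 1 ≤ j i) {k : ℕ} (hk : k < ∑ i, j i) :
    k + phi j k ≤ ∑ i, j i := by
  have h := (isLeast_phi hk).1
  have h1 := lt_tailSize_of_lt_phi hk (Nat.sub_lt h.1 Nat.one_pos)
  have h2 := headSize_add_tailSize j (phi j k - 1)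
  have h3 : (firstBlocks m (phi j k - 1)).card • 1 ≤ headSize j (phi j k - 1) :=
    Finset.card_nsmul_le_sum _ _ _ fun i _ => hj i
  rw [card_firstBlocks (by have := h.2.1; omega)] at h3
  simp only [smul_eq_mul, mul_one] at h3
  omega

/-- An exchange argument: `I \ F` and `F \ I` have equal cardinality, and `j r` separates the block
sizes outside `F` from those inside. Equality of the sums forces every exchanged block to have size
`j r`. -/
theorem tailSize_le_sum_compl_and_eq_iff (hanti : Antitone j) (r : Fin m) (I : Finset (Fin m))
    (hI : I.card = r.val + 1) :
    tailSize j (r.val + 1) ≤ ∑ i ∈ Iᶜ, j i ∧ (tailSize j (r.val + 1) = ∑ i ∈ Iᶜ, j i ↔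
      (∀ i ∈ I, j r ≤ j i) ∧ (∀ i ∉ I, j i ≤ j r)) := by
  set F := firstBlocks m (r.val + 1) with hF
  have hFc : F.card = r.val + 1 := card_firstBlocks r.2
  have hmem : ∀ i, i ∈ F ↔ i ≤ r := by
    intro i
    simp only [hF, firstBlocks, Finset.mem_filter, Finset.mem_univ, true_and, Fin.le_def]
    omega
  have hFge : ∀ i ∈ F, j r ≤ j i := fun i hi => hanti ((hmem i).1 hi)
  have hFle : ∀ i, i ∉ F → j i ≤ j r := fun i hi => hanti (not_le.1 fun h => hi ((hmem i).2 h)).le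
  have hcard : (I \ F).card = (F \ I).card := by
    have h1 := Finset.card_sdiff_add_card_inter I F
    have h2 := Finset.card_sdiff_add_card_inter F I
    rw [Finset.inter_comm] at h2
    omega
  have hsum : ∑ i ∈ F \ I, j i + ∑ i ∈ (F ∪ I)ᶜ, j i = ∑ i ∈ Iᶜ, j i := by
    rw [← Finset.sum_union]
    · congr 1
      ext i; simp; tauto
    · rw [Finset.disjoint_left]; intro i; simp; tauto
  have hsum' : ∑ i ∈ I \ F, j i + ∑ i ∈ (F ∪ I)ᶜ, j i = tailSize j (r.val + 1) := by
    rw [← Finset.sum_union]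
    · rw [tailSize]
      congr 1
      ext i; simp [← hF]; tauto
    · rw [Finset.disjoint_left]; intro i; simp; tauto
  have hup : ∑ i ∈ I \ F, j i ≤ ∑ i ∈ I \ F, j r :=
    Finset.sum_le_sum fun i hi => hFle i (Finset.mem_sdiff.1 hi).2
  have hlo : ∑ i ∈ F \ I, j r ≤ ∑ i ∈ F \ I, j i :=
    Finset.sum_le_sum fun i hi => hFge i (Finset.mem_sdiff.1 hi).1
  have hmid : ∑ i ∈ I \ F, j r = ∑ i ∈ F \ I, j r := by simp [hcard]
  refine ⟨by omega, fun h => ?_, fun ⟨h1, h2⟩ => ?_⟩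
  · have e1 := (Finset.sum_eq_sum_iff_of_le
      (fun i (hi : i ∈ I \ F) => hFle i (Finset.mem_sdiff.1 hi).2)).1 (by omega)
    have e2 := (Finset.sum_eq_sum_iff_of_le
      (fun i (hi : i ∈ F \ I) => hFge i (Finset.mem_sdiff.1 hi).1)).1 (by omega)
    constructor
    · intro i hi
      by_cases hiF : i ∈ F
      · exact hFge i hiF
      · exact (e1 i (Finset.mem_sdiff.2 ⟨hi, hiF⟩)).ge
    · intro i hi
      by_cases hiF : i ∈ F
      · exact (e2 i (Finset.mem_sdiff.2 ⟨hiF, hi⟩)).ge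
      · exact hFle i hiF
  · have e1 : ∑ i ∈ I \ F, j r ≤ ∑ i ∈ I \ F, j i :=
      Finset.sum_le_sum fun i hi => h1 i (Finset.mem_sdiff.1 hi).1
    have e2 : ∑ i ∈ F \ I, j i ≤ ∑ i ∈ F \ I, j r :=
      Finset.sum_le_sum fun i hi => h2 i (Finset.mem_sdiff.1 hi).2
    omega

theorem tailSize_le_sum_compl (hanti : Antitone j) (I : Finset (Fin m)) :
    tailSize j I.card ≤ ∑ i ∈ Iᶜ, j i := by
  rcases Nat.eq_zero_or_pos I.card with h | h
  · have : I = ∅ := Finset.card_eq_zero.1 h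
    subst this
    simp [tailSize, firstBlocks]
  · have hm : I.card ≤ m := by simpa using I.card_le_univ
    have := (tailSize_le_sum_compl_and_eq_iff hanti ⟨I.card - 1, by omega⟩ I
      (by simp only; omega)).1
    simpa only [Nat.sub_add_cancel h] using this

/-- At such a `k`, the order condition defining `biggestBlockSets` becomes the weight condition that
appears in the determinant expansion. -/
theorem mem_biggestBlockSets_iff (hanti : Antitone j) {k : ℕ} (hk : k < ∑ i, j i)
    (ht : k = tailSize j (phi j k)) (I : Finset (Fin m)) :
    I ∈ biggestBlockSets j k ↔ I.card = phi j k ∧ ∑ i ∈ Iᶜ, j i = k := by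
  have hφ := (isLeast_phi hk).1
  simp only [biggestBlockSets, Finset.mem_filter, Finset.mem_univ, true_and]
  refine and_congr_right fun hI => ?_
  have hr : phi j k - 1 < m := by have := hφ.2.1; have := hφ.1; omega
  have hr' : phi j k - 1 + 1 = phi j k := Nat.sub_add_cancel hφ.1
  have h := (tailSize_le_sum_compl_and_eq_iff hanti ⟨phi j k - 1, hr⟩ I
    (by simp only [hr']; exact hI)).2
  simp only [hr'] at h
  rw [← ht] at h
  rw [eq_comm, h]
  constructor
  · intro h1
    exact h1 ⟨phi j k - 1, hr⟩ hr'
  · intro h1 r hrr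
    have : r = ⟨phi j k - 1, hr⟩ := Fin.ext (by simp only; omega)
    rw [this]
    exact h1

variable {s : ℕ} {mult size : Fin s → ℕ}

theorem exists_group (hg : IsGrouping j mult size) (i : Fin m) :
    ∃ l : Fin s, ∑ l' ∈ Finset.Iio l, mult l' ≤ i.val ∧ i.val < ∑ l' ∈ Finset.Iic l, mult l' := by
  have hex : ∃ l : Fin s, i.val < ∑ l' ∈ Finset.Iic l, mult l' := by
    have hi := i.2
    rcases Nat.eq_zero_or_pos s with rfl | hs
    · have := hg.total
      simp at this
      omega
    · refine ⟨⟨s - 1, by omega⟩, ?_⟩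
      have : Finset.Iic (⟨s - 1, by omega⟩ : Fin s) = Finset.univ := by
        ext l; simp only [Finset.mem_Iic, Fin.le_def, Finset.mem_univ, iff_true]; omega
      rw [this, ← hg.total]
      exact hi
  obtain ⟨l, hl, hmin⟩ := WellFounded.has_min (wellFounded_lt (α := Fin s))
    {l | i.val < ∑ l' ∈ Finset.Iic l, mult l'} hex
  refine ⟨l, ?_, hl⟩
  by_contra! hlt
  rcases Nat.eq_zero_or_pos l.val with h0 | hpos
  · have : Finset.Iio l = ∅ := by
      ext l'; simp only [Finset.mem_Iio, Fin.lt_def]; simp [h0]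
    simp [this] at hlt
  · refine hmin ⟨l.val - 1, by omega⟩ ?_ (by simp only [Fin.lt_def]; omega)
    have : Finset.Iic (⟨l.val - 1, by omega⟩ : Fin s) = Finset.Iio l := by
      ext l'; simp only [Finset.mem_Iio, Finset.mem_Iic, Fin.lt_def, Fin.le_def]; omega
    simpa only [Set.mem_ofPred_eq, this] using hlt

theorem sum_Iic_le_of_lt {l l' : Fin s} (h : l < l') (mult : Fin s → ℕ) :
    ∑ x ∈ Finset.Iic l, mult x ≤ ∑ x ∈ Finset.Iio l', mult x :=
  Finset.sum_le_sum_of_subset fun _ hx => Finset.mem_Iio.2 ((Finset.mem_Iic.1 hx).trans_lt h)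

/-- The blocks after the cut are sorted by group; each group `l'` is the difference of two initial
segments and has `mult l'` elements. -/
theorem tailSize_sum_Iic (hg : IsGrouping j mult size) (l : Fin s) :
    tailSize j (∑ l' ∈ Finset.Iic l, mult l') = ∑ l' ∈ Finset.Ioi l, mult l' * size l' := by
  choose g hg1 hg2 using exists_group hg
  have huniq : ∀ i l, ∑ l' ∈ Finset.Iio l, mult l' ≤ i.val →
      i.val < ∑ l' ∈ Finset.Iic l, mult l' → g i = l := by
    intro i l h1 h2
    rcases lt_trichotomy (g i) l with h | h | h
    · have := sum_Iic_le_of_lt h mult; have := hg2 i; omega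
    · exact h
    · have := sum_Iic_le_of_lt h mult; have := hg1 i; omega
  have hmem : ∀ i, i ∈ (firstBlocks m (∑ l' ∈ Finset.Iic l, mult l'))ᶜ ↔ g i ∈ Finset.Ioi l := by
    intro i
    simp only [firstBlocks, Finset.mem_compl, Finset.mem_filter, Finset.mem_univ, true_and,
      not_lt, Finset.mem_Ioi]
    constructor
    · intro h
      by_contra! h'
      have : ∑ x ∈ Finset.Iic (g i), mult x ≤ ∑ x ∈ Finset.Iic l, mult x :=
        Finset.sum_le_sum_of_subset (Finset.Iic_subset_Iic.2 h')
      have := hg2 i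
      omega
    · intro h
      have := sum_Iic_le_of_lt h mult
      have := hg1 i
      omega
  rw [tailSize, ← Finset.sum_fiberwise_of_maps_to (g := g) (fun i hi => (hmem i).1 hi)]
  refine Finset.sum_congr rfl fun l' hl' => ?_
  have hIic : ∑ x ∈ Finset.Iic l', mult x = ∑ x ∈ Finset.Iio l', mult x + mult l' := by
    rw [← Finset.Iio_insert, Finset.sum_insert (by simp), add_comm]
  have hle : ∑ x ∈ Finset.Iic l', mult x ≤ m := by
    conv_rhs => rw [hg.total]
    exact Finset.sum_le_sum_of_subset (Finset.subset_univ _)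
  rw [Finset.sum_congr rfl (g := fun _ => size l'), Finset.sum_const, smul_eq_mul]
  · congr 1
    have : ((firstBlocks m (∑ l' ∈ Finset.Iic l, mult l'))ᶜ.filter fun i => g i = l')
        = firstBlocks m (∑ x ∈ Finset.Iic l', mult x) \
          firstBlocks m (∑ x ∈ Finset.Iio l', mult x) := by
      ext i
      rw [Finset.mem_filter, hmem]
      simp only [firstBlocks, Finset.mem_sdiff, Finset.mem_filter, Finset.mem_univ, true_and,
        not_lt]
      constructor
      · rintro ⟨-, rfl⟩
        exact ⟨hg2 i, hg1 i⟩
      · rintro ⟨h1, h2⟩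
        have := huniq i l' h2 h1
        exact ⟨this ▸ hl', this⟩
    rw [this, Finset.card_sdiff_of_subset, card_firstBlocks hle, card_firstBlocks (by omega)]
    · omega
    · intro i
      simp only [firstBlocks, Finset.mem_filter, Finset.mem_univ, true_and]
      omega
  · intro i hi
    have hi' := (Finset.mem_filter.1 hi).2
    exact hg.eq_size l' i (hi' ▸ hg1 i) (hi' ▸ hg2 i)

theorem one_le_sum_Iic (hg : IsGrouping j mult size) (l : Fin s) :
    1 ≤ ∑ l' ∈ Finset.Iic l, mult l' :=
  (hg.one_le_mult l).trans (Finset.single_le_sum (fun _ _ => Nat.zero_le _) (by simp))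

theorem sum_Iic_le (hg : IsGrouping j mult size) (l : Fin s) :
    ∑ l' ∈ Finset.Iic l, mult l' ≤ m := by
  conv_rhs => rw [hg.total]
  exact Finset.sum_le_sum_of_subset (Finset.subset_univ _)

theorem corner_lt (hj : ∀ i, 1 ≤ j i) (hg : IsGrouping j mult size) (l : Fin s) :
    ∑ l' ∈ Finset.Ioi l, mult l' * size l' < ∑ i, j i := by
  rw [← tailSize_sum_Iic hg]
  have := tailSize_strictAntiOn hj (one_le_sum_Iic hg l) (sum_Iic_le hg l)
  have h0 : tailSize j 0 = ∑ i, j i := by simp [tailSize, firstBlocks]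
  omega

theorem phi_corner (hj : ∀ i, 1 ≤ j i) (hg : IsGrouping j mult size) (l : Fin s) :
    phi j (∑ l' ∈ Finset.Ioi l, mult l' * size l') = ∑ l' ∈ Finset.Iic l, mult l' := by
  refine (isLeast_phi (corner_lt hj hg l)).unique ⟨⟨one_le_sum_Iic hg l, sum_Iic_le hg l,
    (tailSize_sum_Iic hg l).le⟩, fun r hr => ?_⟩
  by_contra! h
  have := tailSize_strictAntiOn hj h (sum_Iic_le hg l)
  rw [tailSize_sum_Iic hg] at this
  have := hr.2.2
  omega

/-- The cut falls between two groups, so sizes drop strictly there and no tie leaves a choice. -/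
theorem biggestBlockSets_corner (hj : ∀ i, 1 ≤ j i) (hanti : Antitone j)
    (hg : IsGrouping j mult size) (l : Fin s) :
    biggestBlockSets j (∑ l' ∈ Finset.Ioi l, mult l' * size l')
      = {firstBlocks m (∑ l' ∈ Finset.Iic l, mult l')} := by
  have hφ := phi_corner hj hg l
  have hm := sum_Iic_le hg l
  have h1 := one_le_sum_Iic hg l
  ext I
  rw [Finset.mem_singleton]
  constructor
  · intro hI
    simp only [biggestBlockSets, Finset.mem_filter, Finset.mem_univ, true_and, hφ] at hI
    refine Finset.eq_of_subset_of_card_le (fun i hi => ?_) (by rw [card_firstBlocks hm, hI.1])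
    -- The last block of group `l`, in 0-based position.
    set r : Fin m := ⟨∑ l' ∈ Finset.Iic l, mult l' - 1, by omega⟩ with hr
    have hri := (hI.2 r (by simp only [hr]; omega)).1 i hi
    have hsize : j r = size l := by
      refine hg.eq_size l r ?_ ?_
      · have : ∑ x ∈ Finset.Iic l, mult x = ∑ x ∈ Finset.Iio l, mult x + mult l := by
          rw [← Finset.Iio_insert, Finset.sum_insert (by simp), add_comm]
        have := hg.one_le_mult l
        simp only [hr]; omega
      · simp only [hr]; omega
    simp only [firstBlocks, Finset.mem_filter, Finset.mem_univ, true_and]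
    by_contra! hle
    obtain ⟨l', hl1, hl2⟩ := exists_group hg i
    rw [hsize, hg.eq_size l' i hl1 hl2, hg.strictAnti.le_iff_ge] at hri
    have : ∑ x ∈ Finset.Iic l', mult x ≤ ∑ x ∈ Finset.Iic l, mult x :=
      Finset.sum_le_sum_of_subset (Finset.Iic_subset_Iic.2 hri)
    omega
  · rintro rfl
    rw [mem_biggestBlockSets_iff hanti (corner_lt hj hg l)
      (by rw [hφ, tailSize_sum_Iic hg]), hφ]
    exact ⟨card_firstBlocks hm, tailSize_sum_Iic hg l⟩

end BlockSizes

/-! ### Vanishing and leading terms of the mixed determinants. -/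

section LeadingCoefficient

variable {ι K : Type*} [Fintype ι] [DecidableEq ι] [Field K] {m : ℕ} {j : Fin m → ℕ}
  (hj : ∀ i, 1 ≤ j i) {e : ((i : Fin m) × Fin (j i)) → ι}

theorem tailSize_antitone (j : Fin m → ℕ) : Antitone (tailSize j) := by
  intro r r' h
  refine Finset.sum_le_sum_of_subset fun i => ?_
  simp only [firstBlocks, Finset.mem_compl, Finset.mem_filter, Finset.mem_univ, true_and]
  omega

omit [Fintype ι] in
theorem card_heads_mem_le (he : Function.Injective e) (S : Finset ι) :
    (Finset.univ.filter fun i => chainHead hj e i ∈ S).card ≤ S.card :=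
  Finset.card_le_card_of_injOn (chainHead hj e) (fun i hi => by simpa using hi)
    (chainHead_injective hj he).injOn

theorem tailSize_le_sum_headLength_compl (hanti : Antitone j) (he : Function.Injective e)
    (S : Finset ι) :
    tailSize j (Finset.univ.filter fun i => chainHead hj e i ∈ S).card
      ≤ ∑ c ∈ Sᶜ, headLength hj e c := by
  rw [sum_headLength_compl hj he]
  refine (tailSize_le_sum_compl hanti _).trans_eq (Finset.sum_congr ?_ fun _ _ => rfl)
  ext i
  simp

-- A set `S` of `r` columns contains at most `r` heads, so the factors surviving outside `S` already
-- have total degree at least `tailSize j r`.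
include hj in
theorem mixedDet_eq_zero_of_lt_tailSize (hanti : Antitone j) (he : Function.Injective e)
    {P : Matrix ι ι K} (hP : IsShift P e) (D : Matrix ι ι K) {k r : ℕ} (hk : k < tailSize j r) :
    mixedDet k r P D = 0 := by
  have h : ∀ S : Finset ι, S.card = r → k < ∑ c ∈ Sᶜ, headLength hj e c := fun S hS =>
    hk.trans_le ((tailSize_antitone j (hS ▸ card_heads_mem_le hj he S)).trans
      (tailSize_le_sum_headLength_compl hj hanti he S))
  rw [mixedDet_eq_sum_closedShift hj he hP D k r fun S hS => (h S hS).le]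
  refine Finset.sum_eq_zero fun S hS => ?_
  have hS' := Finset.mem_filter.1 hS
  exact absurd hS'.2 (h S (Finset.mem_powersetCard.1 hS'.1).2).ne'

/-- With `r = 0` only the empty set occurs. Together with `charCoeff_self` this identifies the
determinant of `closedShift` with `c_N(0)`. -/
theorem mixedDet_sum_zero (he : Function.Injective e) {P : Matrix ι ι K} (hP : IsShift P e)
    (D : Matrix ι ι K) : mixedDet (∑ i, j i) 0 P D = (closedShift hj P e).det := by
  have hs : ∑ c ∈ (∅ : Finset ι)ᶜ, headLength hj e c = ∑ i, j i := by
    rw [sum_headLength_compl hj he]; simp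
  rw [mixedDet_eq_sum_closedShift hj he hP D]
  · rw [Finset.powersetCard_zero, Finset.sum_filter, Finset.sum_singleton, if_pos hs]
    congr 1
  · intro S hS
    rw [Finset.card_eq_zero.1 hS, hs]

theorem mixedDet_phi_eq_sum_minors (hanti : Antitone j) (he : Function.Injective e)
    {P : Matrix ι ι K} (hP : IsShift P e) (D Y : Matrix ι ι K)
    (hY : closedShift hj P e * Y = D) {k : ℕ} (hk : k < ∑ i, j i)
    (ht : k = tailSize j (phi j k)) :
    mixedDet k (phi j k) P D = (closedShift hj P e).det * ∑ I ∈ biggestBlockSets j k,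
      ((Y.submatrix (chainHead hj e) (chainHead hj e)).submatrix
        (fun i : I => (i : Fin m)) (fun i : I => (i : Fin m))).det := by
  have hφ := (isLeast_phi hk).1
  set f : Fin m ↪ ι := ⟨chainHead hj e, chainHead_injective hj he⟩ with hf
  have hwt : ∀ I : Finset (Fin m), ∑ c ∈ (I.map f)ᶜ, headLength hj e c = ∑ i ∈ Iᶜ, j i := by
    intro I
    rw [sum_headLength_compl hj he]
    refine Finset.sum_congr ?_ fun _ _ => rfl
    ext i
    have : chainHead hj e i = f i := rfl
    rw [Finset.mem_filter, this, Finset.mem_map' f]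
    simp
  rw [mixedDet_eq_sum_closedShift hj he hP D, Finset.mul_sum]
  · symm
    refine Finset.sum_of_injOn (fun I => I.map f) (Finset.map_injective f).injOn ?_ ?_ ?_
    · intro I hI
      have hI' := (mem_biggestBlockSets_iff hanti hk ht I).1 hI
      simp only [Finset.coe_filter, Finset.mem_powersetCard, Finset.subset_univ, true_and,
        Set.mem_ofPred_eq, Finset.card_map]
      exact ⟨hI'.1, (hwt I).trans hI'.2⟩
    · intro S hS hS'
      exfalso
      simp only [Finset.mem_filter, Finset.mem_powersetCard, Finset.subset_univ, true_and] at hS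
      -- If some element of `S` were not a head, `I` would have fewer than `φ(k)` elements, and
      -- strict monotonicity of `tailSize` would make the weight exceed `k`.
      set I := Finset.univ.filter fun i => chainHead hj e i ∈ S with hI
      have h1 := tailSize_le_sum_headLength_compl hj hanti he S
      have h2 := card_heads_mem_le hj he S
      rw [← hI, hS.2] at h1
      rw [← hI, hS.1] at h2
      have hcard : I.card = phi j k := by
        refine le_antisymm h2 ?_
        by_contra! hlt
        have := tailSize_strictAntiOn hj hlt hφ.2.1
        omega
      have hmap : I.map f = S := by
        refine Finset.eq_of_subset_of_card_le (fun c hc => ?_) (by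
          rw [Finset.card_map, hcard, hS.1])
        obtain ⟨i, hi, rfl⟩ := Finset.mem_map.1 hc
        exact (Finset.mem_filter.1 hi).2
      refine hS' ⟨I, (mem_biggestBlockSets_iff hanti hk ht I).2 ⟨hcard, ?_⟩, hmap⟩
      rw [← hwt, hmap, hS.2]
    · intro I _
      rw [det_mixColumns _ Y D hY, ← Matrix.det_submatrix_equiv_self ((Equiv.Set.image f I f.injective).trans
        (Equiv.setCongr (Finset.coe_map f I).symm))]
      rfl
  · intro S hS
    calc k = tailSize j (phi j k) := ht
      _ ≤ _ := tailSize_antitone j (hS ▸ card_heads_mem_le hj he S)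
      _ ≤ _ := tailSize_le_sum_headLength_compl hj hanti he S

end LeadingCoefficient

/-! ### The Krein form and its invariance under symplectic maps. -/

section Krein

variable {n : ℕ}

theorem herm_eq_dotProduct {ι : Type*} [Fintype ι] (x y : ι → ℂ) : herm x y = x ⬝ᵥ star y := rfl

theorem J2n_eq_neg_J (R : Type*) [CommRing R] : J2n n R = -Matrix.J (Fin n) R := by
  simp [J2n, Matrix.J, Matrix.fromBlocks_neg]

theorem toC_mulVec_star {ι : Type*} [Fintype ι] (M : Matrix ι ι ℝ) (x : ι → ℂ) :
    star (toC M *ᵥ x) = toC M *ᵥ star x := by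
  funext a
  simp [toC, Matrix.mulVec, dotProduct]

theorem toC_J2n : toC (J2n n ℝ) = J2n n ℂ := by
  ext a c
  rcases a with a | a <;> rcases c with c | c <;>
    simp [toC, J2n, Matrix.one_apply, apply_ite Complex.ofReal]

theorem toC_mul {ι : Type*} [Fintype ι] (M N : Matrix ι ι ℝ) : toC (M * N) = toC M * toC N := by
  ext a c
  simp [toC, Matrix.mul_apply]

theorem kreinForm_eq (x y : Fin n ⊕ Fin n → ℂ) :
    kreinForm x y = Complex.I * (x ⬝ᵥ J2n n ℂ *ᵥ star y) := by
  rw [kreinForm, herm_eq_dotProduct, ← toC_J2n, toC_mulVec_star]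

/-- The linear form `x ↦ (x, y)_G`. -/
def kreinFunctional (y : Fin n ⊕ Fin n → ℂ) : (Fin n ⊕ Fin n → ℂ) →ₗ[ℂ] ℂ where
  toFun x := kreinForm x y
  map_add' x x' := by simp [kreinForm_eq, add_dotProduct, mul_add]
  map_smul' a x := by simp [kreinForm_eq, smul_dotProduct]; ring

theorem kreinForm_smul_right (a : ℂ) (x y : Fin n ⊕ Fin n → ℂ) :
    kreinForm x (a • y) = star a * kreinForm x y := by
  simp [kreinForm_eq, Matrix.mulVec_smul]
  ring

theorem kreinForm_sum_right {κ : Type*} (s : Finset κ) (x : Fin n ⊕ Fin n → ℂ)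
    (y : κ → Fin n ⊕ Fin n → ℂ) :
    kreinForm x (∑ i ∈ s, y i) = ∑ i ∈ s, kreinForm x (y i) := by
  simp only [kreinForm_eq, star_sum, Matrix.mulVec_sum, dotProduct_sum, Finset.mul_sum]

theorem kreinForm_symplectic {g : Matrix (Fin n ⊕ Fin n) (Fin n ⊕ Fin n) ℝ}
    (hg : g ∈ Matrix.symplecticGroup (Fin n) ℝ) (x y : Fin n ⊕ Fin n → ℂ) :
    kreinForm (toC g *ᵥ x) (toC g *ᵥ y) = kreinForm x y := by
  have h : (toC g)ᵀ * J2n n ℂ * toC g = J2n n ℂ := by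
    have h1 := SymplecticGroup.mem_iff'.1 hg
    have h2 : gᵀ * J2n n ℝ * g = J2n n ℝ := by
      rw [J2n_eq_neg_J, Matrix.mul_neg, Matrix.neg_mul, h1]
    have h3 := congrArg toC h2
    rw [toC_mul, toC_mul, toC_J2n] at h3
    exact h3
  rw [kreinForm_eq, kreinForm_eq, toC_mulVec_star, ← Matrix.vecMul_transpose,
    ← Matrix.dotProduct_mulVec, Matrix.mulVec_mulVec, Matrix.mulVec_mulVec, h]

/-- Invariance gives `conj(lam) (g x, y)_G = (x, y)_G`. As `lam` lies on the unit circle, `(g x,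
y)_G = lam (x, y)_G`. -/
theorem kreinForm_sub_eq_zero {g : Matrix (Fin n ⊕ Fin n) (Fin n ⊕ Fin n) ℝ}
    (hg : g ∈ Matrix.symplecticGroup (Fin n) ℝ) {lam : ℂ} (hlam : lam * star lam = 1)
    {y : Fin n ⊕ Fin n → ℂ} (hy : toC g *ᵥ y = lam • y) (x : Fin n ⊕ Fin n → ℂ) :
    kreinForm ((lam • (1 : Matrix (Fin n ⊕ Fin n) (Fin n ⊕ Fin n) ℂ) - toC g) *ᵥ x) y = 0 := by
  have h1 : kreinForm (toC g *ᵥ x) y = lam * kreinForm x y := by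
    have h2 := kreinForm_symplectic hg x y
    rw [hy, kreinForm_smul_right] at h2
    rw [← h2, ← mul_assoc, hlam, one_mul]
  have h2 := map_sub (kreinFunctional y) (lam • x) (toC g *ᵥ x)
  rw [map_smul] at h2
  rw [Matrix.sub_mulVec, Matrix.smul_mulVec, Matrix.one_mulVec]
  refine h2.trans ?_
  change lam * kreinForm x y - kreinForm (toC g *ᵥ x) y = 0
  rw [h1, sub_self]

theorem J2n_mul_J2n (R : Type*) [CommRing R] : J2n n R * J2n n R = -1 := by
  rw [J2n_eq_neg_J, neg_mul_neg, Matrix.J_squared]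

theorem eq_zero_of_kreinForm_eq_zero {y : Fin n ⊕ Fin n → ℂ} (h : ∀ x, kreinForm x y = 0) :
    y = 0 := by
  have h1 : J2n n ℂ *ᵥ star y = 0 := by
    refine dotProduct_eq_zero _ fun x => ?_
    have := h x
    rw [kreinForm_eq] at this
    rw [dotProduct_comm]
    exact (mul_eq_zero.1 this).resolve_left Complex.I_ne_zero
  have h2 := congrArg (J2n n ℂ *ᵥ ·) h1
  simp only [Matrix.mulVec_mulVec, J2n_mul_J2n, Matrix.neg_mulVec, Matrix.one_mulVec,
    Matrix.mulVec_zero, neg_eq_zero, star_eq_zero] at h2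
  exact h2

theorem kreinForm_J2n_mulVec (x y : Fin n ⊕ Fin n → ℂ) :
    kreinForm (J2n n ℂ *ᵥ x) y = Complex.I * herm x y := by
  have hT : (J2n n ℂ)ᵀ = -J2n n ℂ := by
    rw [J2n_eq_neg_J, Matrix.transpose_neg, Matrix.J_transpose]
  rw [kreinForm_eq, herm_eq_dotProduct, ← Matrix.vecMul_transpose, ← Matrix.dotProduct_mulVec,
    Matrix.mulVec_mulVec, hT, neg_mul, J2n_mul_J2n, neg_neg, Matrix.one_mulVec]

end Krein

/-! ### Passing from the Jordan chains to matrices, and the coefficients `charCoeff`. -/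

section JordanBasis

variable {n m : ℕ} {g : Matrix (Fin n ⊕ Fin n) (Fin n ⊕ Fin n) ℂ} {lam : ℂ} {j : Fin m → ℕ}
  {ξ : Fin m → ℕ → (Fin n ⊕ Fin n → ℂ)}

theorem IsJordanBasis.finrank_invSpace (h : IsJordanBasis g lam j ξ) :
    Module.finrank ℂ (invSpace g lam) = ∑ i, j i := by
  rw [← h.span_eq, finrank_span_eq_card h.linearIndependent]
  simp

theorem IsJordanBasis.exists_basis (h : IsJordanBasis g lam j ξ) :
    ∃ (b : Module.Basis (Fin (2 * n)) ℂ (Fin n ⊕ Fin n → ℂ))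
      (e : ((i : Fin m) × Fin (j i)) → Fin (2 * n)), Function.Injective e ∧
        ∀ p, b (e p) = ξ p.1 (p.2 + 1) := by
  set b0 := Module.Basis.sumExtend h.linearIndependent with hb0
  have hcard : Module.finrank ℂ (Fin n ⊕ Fin n → ℂ) = 2 * n := by
    simp; omega
  have := FiniteDimensional.fintypeBasisIndex b0
  have hc : Fintype.card (((i : Fin m) × Fin (j i)) ⊕
      Module.Basis.sumExtendIndex h.linearIndependent) = 2 * n := by
    rw [← hcard, Module.finrank_eq_card_basis b0]
  let E := Fintype.equivFinOfCardEq hc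
  refine ⟨b0.reindex E, fun p => E (Sum.inl p), fun p q hpq => ?_, fun p => ?_⟩
  · exact Sum.inl_injective (E.injective hpq)
  · rw [Module.Basis.reindex_apply, Equiv.symm_apply_apply, hb0]
    simp only [Module.Basis.sumExtend, Module.Basis.reindex_apply, Module.Basis.extend_apply_self]
    rfl

/-- The map `lam • 1 - g`. -/
def shiftMap (g : Matrix (Fin n ⊕ Fin n) (Fin n ⊕ Fin n) ℂ) (lam : ℂ) :
    (Fin n ⊕ Fin n → ℂ) →ₗ[ℂ] (Fin n ⊕ Fin n → ℂ) :=
  Matrix.toLin' (lam • (1 : Matrix (Fin n ⊕ Fin n) (Fin n ⊕ Fin n) ℂ) - g)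

variable {b : Module.Basis (Fin (2 * n)) ℂ (Fin n ⊕ Fin n → ℂ)}
  {e : ((i : Fin m) × Fin (j i)) → Fin (2 * n)}

theorem IsJordanBasis.shiftMap_apply (h : IsJordanBasis g lam j ξ) (i : Fin m) (a : ℕ)
    (ha : a < j i) : shiftMap g lam (ξ i (a + 1)) = ξ i a := by
  rw [shiftMap, Matrix.toLin'_apply, Matrix.sub_mulVec, Matrix.smul_mulVec, Matrix.one_mulVec,
    h.chain i a ha, sub_sub_cancel]

theorem IsJordanBasis.isShift (h : IsJordanBasis g lam j ξ)
    (hb : ∀ p, b (e p) = ξ p.1 (p.2 + 1)) :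
    IsShift (LinearMap.toMatrix b b (shiftMap g lam)) e := by
  have hv : ∀ i a, a < j i → chainVec ℂ e i a = b.repr (ξ i (a + 1)) := by
    intro i a ha
    have := hb ⟨i, ⟨a, ha⟩⟩
    rw [chainVec, dif_pos ha, ← this, Module.Basis.repr_self, Finsupp.single_eq_pi_single]
  intro i a ha
  rw [hv i a ha, LinearMap.toMatrix_mulVec_repr, h.shiftMap_apply i a ha]
  split_ifs with h0
  · rw [h0, h.zero, map_zero]; rfl
  · rw [hv i (a - 1) (by omega), Nat.sub_add_cancel (by omega)]

/-- The Taylor shift turns `X - (g - w M)` into `X + (lam - g) + w M`; both the characteristic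
polynomial and the expansion may be computed in the basis `b`. -/
theorem charCoeff_eq (k : ℕ) (g M : Matrix (Fin n ⊕ Fin n) (Fin n ⊕ Fin n) ℂ) (lam w : ℂ)
    (b : Module.Basis (Fin (2 * n)) ℂ (Fin n ⊕ Fin n → ℂ)) :
    charCoeff (g - w • M) lam k = ∑ r ∈ Finset.range (2 * n + 1), w ^ r *
      mixedDet k r (LinearMap.toMatrix b b (shiftMap g lam))
        (LinearMap.toMatrix b b (Matrix.toLin' M)) := by
  have h := coeff_det_X_smul_add k (LinearMap.toMatrix b b (shiftMap g lam))
    (LinearMap.toMatrix b b (Matrix.toLin' M)) w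
  rw [Fintype.card_fin] at h
  rw [← h, charCoeff]
  have h1 : (g - w • M).charpoly
      = (LinearMap.toMatrix b b (Matrix.toLin' (g - w • M))).charpoly := by
    rw [LinearMap.charpoly_toMatrix, Matrix.charpoly_toLin']
  have h0 : ∀ p : Polynomial ℂ, Polynomial.taylor lam p = Polynomial.taylorAlgHom lam p :=
    fun _ => rfl
  rw [h1, Matrix.charpoly, h0, AlgHom.map_det]
  congr 2
  rw [AlgHom.mapMatrix_apply]
  have h2 : LinearMap.toMatrix b b (shiftMap g lam) + w • LinearMap.toMatrix b b (Matrix.toLin' M)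
      = lam • (1 : Matrix (Fin (2 * n)) (Fin (2 * n)) ℂ)
        - LinearMap.toMatrix b b (Matrix.toLin' (g - w • M)) := by
    rw [shiftMap]
    simp only [map_sub, map_smul, Matrix.toLin'_one, LinearMap.toMatrix_id]
    abel
  rw [h2]
  ext1 a c
  by_cases hac : a = c
  · subst hac
    simp [Polynomial.taylor_X, Polynomial.taylor_C]
    ring
  · simp [hac, Polynomial.taylor_C]

theorem charCoeff_self (k : ℕ) (D : Matrix (Fin (2 * n)) (Fin (2 * n)) ℂ)
    (b : Module.Basis (Fin (2 * n)) ℂ (Fin n ⊕ Fin n → ℂ)) :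
    charCoeff g lam k = mixedDet k 0 (LinearMap.toMatrix b b (shiftMap g lam)) D := by
  have h := charCoeff_eq k g (Matrix.toLin' |>.symm (Matrix.toLin b b D)) lam 0 b
  rw [zero_smul, sub_zero, Finset.sum_range_succ'] at h
  simpa using h

/-- The dimension of the generalized eigenspace is the multiplicity of the root `lam`, so this
coefficient is the trailing one of the shifted polynomial. -/
theorem charCoeff_finrank_ne_zero (g : Matrix (Fin n ⊕ Fin n) (Fin n ⊕ Fin n) ℂ) (lam : ℂ) :
    charCoeff g lam (Module.finrank ℂ (invSpace g lam)) ≠ 0 := by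
  have hspace : invSpace g lam = (Module.End.maxGenEigenspace (Matrix.toLin' g) lam) := by
    have hd : Module.finrank ℂ (Fin n ⊕ Fin n → ℂ) = 2 * n := by simp; omega
    rw [Module.End.maxGenEigenspace_eq_genEigenspace_finrank, hd,
      Module.End.genEigenspace_nat, invSpace]
    have : Matrix.toLin' ((lam • (1 : Matrix (Fin n ⊕ Fin n) (Fin n ⊕ Fin n) ℂ) - g) ^ (2 * n))
        = (Matrix.toLin' g - lam • (1 : Module.End ℂ (Fin n ⊕ Fin n → ℂ))) ^ (2 * n) := by
      rw [← neg_sub, Even.neg_pow (even_two_mul n), Matrix.toLin'_pow, map_sub, map_smul,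
        Matrix.toLin'_one]
      rfl
    rw [this]
  rw [hspace, LinearMap.finrank_maxGenEigenspace_eq, Matrix.charpoly_toLin', charCoeff,
    Polynomial.rootMultiplicity_eq_natTrailingDegree, ← Polynomial.taylor_apply]
  refine Polynomial.trailingCoeff_eq_zero.not.2 ?_
  rw [Polynomial.taylor_eq_zero]
  exact g.charpoly_monic.ne_zero

theorem tendsto_charpoly_div_pow (g : Matrix (Fin n ⊕ Fin n) (Fin n ⊕ Fin n) ℂ) (lam : ℂ) (N : ℕ)
    (hN : ∀ k < N, charCoeff g lam k = 0) :
    Tendsto (fun z : ℂ => (z • (1 : Matrix (Fin n ⊕ Fin n) (Fin n ⊕ Fin n) ℂ) - g).det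
      / (z - lam) ^ N) (𝓝[≠] lam) (𝓝 (charCoeff g lam N)) := by
  obtain ⟨q, hq⟩ := Polynomial.X_pow_dvd_iff.2 hN
  have hval : charCoeff g lam N = q.eval (lam - lam) := by
    rw [charCoeff, hq, Polynomial.coeff_X_pow_mul', if_pos le_rfl, Nat.sub_self, sub_self,
      Polynomial.coeff_zero_eq_eval_zero]
  have hcont : Continuous fun z : ℂ => q.eval (z - lam) := by fun_prop
  rw [hval]
  refine ((hcont.tendsto lam).mono_left nhdsWithin_le_nhds).congr' ?_
  filter_upwards [self_mem_nhdsWithin] with z hz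
  have hz' : z - lam ≠ 0 := sub_ne_zero.2 hz
  have hdet : (z • (1 : Matrix (Fin n ⊕ Fin n) (Fin n ⊕ Fin n) ℂ) - g).det
      = (Polynomial.taylor lam g.charpoly).eval (z - lam) := by
    rw [Polynomial.taylor_eval, sub_add_cancel, Matrix.eval_charpoly]
    congr 2
    ext a c
    simp [Matrix.scalar_apply, Matrix.one_apply, Matrix.diagonal_apply]
  rw [hdet, hq, Polynomial.eval_mul, Polynomial.eval_pow, Polynomial.eval_X,
    mul_div_cancel_left₀ _ (pow_ne_zero _ hz')]

/-- Non-head columns of `closedShift` come from the range of `lam - g`, which `f` kills; only the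
chain ends are seen by `f`. -/
theorem toLin_closedShift_apply (hj : ∀ i, 1 ≤ j i) (he : Function.Injective e)
    (hb : ∀ p, b (e p) = ξ p.1 (p.2 + 1))
    (f : (Fin n ⊕ Fin n → ℂ) →ₗ[ℂ] ℂ) (hf : ∀ x, f (shiftMap g lam x) = 0) (c : Fin (2 * n)) :
    (∀ i, chainHead hj e i = c → f (Matrix.toLin b b
      (closedShift hj (LinearMap.toMatrix b b (shiftMap g lam)) e) (b c)) =
        -(-1) ^ j i * f (ξ i (j i))) ∧
    ((∀ i, chainHead hj e i ≠ c) → f (Matrix.toLin b b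
      (closedShift hj (LinearMap.toMatrix b b (shiftMap g lam)) e) (b c)) = 0) := by
  constructor
  · rintro i rfl
    rw [Matrix.toLin_self]
    simp only [closedShift, replaceHeads_head hj he, Pi.smul_apply, Pi.single_apply, smul_eq_mul,
      mul_ite, mul_one, mul_zero, ite_smul, zero_smul, Finset.sum_ite_eq', Finset.mem_univ, if_true,
      map_smul]
    rw [chainLast, hb]
    simp only [Nat.sub_add_cancel (hj i)]
  · intro hc
    rw [Matrix.toLin_self]
    simp only [closedShift, replaceHeads_of_notMem hj _ _ _ c hc]
    rw [← Matrix.toLin_self b b, Matrix.toLin_toMatrix]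
    exact hf _

end JordanBasis

/-! ### Expansion of the coefficients as `t → 0`. -/

section Asymptotics

theorem isLittleO_sum_neg_pow_sub {R p : ℕ} (hp : p < R) (u : ℕ → ℝ → ℂ)
    (hu : ∀ r, ContinuousAt (u r) 0) (hu0 : ∀ r < p, ∀ t, u r t = 0) :
    (fun t : ℝ => ∑ r ∈ Finset.range R, (-(t : ℂ)) ^ r * u r t - (-(t : ℂ)) ^ p * u p 0)
      =o[𝓝 0] fun t : ℝ => t ^ p := by
  have hpow : ∀ r, (fun t : ℝ => (-(t : ℂ)) ^ r) =O[𝓝 0] fun t : ℝ => t ^ r := fun r =>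
    IsBigO.of_bound 1 (Eventually.of_forall fun t => by simp)
  have hterm : ∀ r ∈ Finset.range R, (fun t : ℝ => (-(t : ℂ)) ^ r * u r t -
      if r = p then (-(t : ℂ)) ^ p * u p 0 else 0) =o[𝓝 0] fun t : ℝ => t ^ p := by
    intro r _
    rcases lt_trichotomy r p with h | h | h
    · simp [hu0 r h, h.ne]
    · subst h
      simp only [if_true, ← mul_sub]
      have h1 : (fun t => u r t - u r 0) =o[𝓝 0] fun _ : ℝ => (1 : ℝ) := by
        rw [isLittleO_one_iff]
        simpa using (hu r).tendsto.sub_const (u r 0)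
      simpa using (hpow r).mul_isLittleO h1
    · simp only [h.ne', if_false, sub_zero]
      have h1 : (u r) =O[𝓝 0] fun _ : ℝ => (1 : ℝ) := (hu r).tendsto.isBigO_one ℝ
      have h2 : (fun t : ℝ => t ^ r) =o[𝓝 0] fun t : ℝ => t ^ p := isLittleO_pow_pow h
      simpa using ((hpow r).trans_isLittleO h2).mul_isBigO h1
  refine (IsLittleO.sum hterm).congr_left fun t => ?_
  rw [Finset.sum_apply, Finset.sum_sub_distrib, Finset.sum_ite_eq', if_pos (Finset.mem_range.2 hp)]

theorem continuous_mixedDet {ι : Type*} [Fintype ι] [DecidableEq ι] (k r : ℕ)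
    (P : Matrix ι ι ℂ) : Continuous fun D : Matrix ι ι ℂ => mixedDet k r P D := by
  unfold mixedDet
  refine continuous_finsetSum _ fun σ _ => Continuous.matrix_det (continuous_matrix fun a c => ?_)
  simp only [selectMatrix, Matrix.of_apply]
  split_ifs <;> fun_prop

variable {n : ℕ}

theorem isLittleO_charCoeff_sub {γ : ℝ → Matrix (Fin n ⊕ Fin n) (Fin n ⊕ Fin n) ℝ}
    {G : Matrix (Fin n ⊕ Fin n) (Fin n ⊕ Fin n) ℝ} (hγ : HasDerivAt γ G 0) (lam : ℂ)
    (b : Module.Basis (Fin (2 * n)) ℂ (Fin n ⊕ Fin n → ℂ)) {k p : ℕ} (hp : p ≤ 2 * n)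
    (h0 : ∀ r < p, ∀ D, mixedDet k r (LinearMap.toMatrix b b (shiftMap (toC (γ 0)) lam)) D = 0) :
    (fun t : ℝ => charCoeff (toC (γ t)) lam k - (-(t : ℂ)) ^ p *
      mixedDet k p (LinearMap.toMatrix b b (shiftMap (toC (γ 0)) lam))
        (LinearMap.toMatrix b b (Matrix.toLin' (toC G)))) =o[𝓝 0] fun t : ℝ => t ^ p := by
  have hγ' : ∀ a c, HasDerivAt (fun t => γ t a c) (G a c) 0 := fun a c =>
    hasDerivAt_pi.1 (hasDerivAt_pi.1 hγ a) c
  -- The entrywise difference quotient, completed at `0` by the derivative, gives an exact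
  -- first-order formula without remainder term. The parameter of `charCoeff_eq` is then `w = -t`.
  set s : ℝ → Matrix (Fin n ⊕ Fin n) (Fin n ⊕ Fin n) ℝ := fun t =>
    Matrix.of fun a c => dslope (fun t => γ t a c) 0 t with hs
  have hsG : s 0 = G := by
    ext a c
    simp [hs, dslope_same, (hγ' a c).deriv]
  have hscont : ContinuousAt s 0 := by
    refine continuousAt_pi.2 fun a => continuousAt_pi.2 fun c => ?_
    exact continuousAt_dslope_same.2 (hγ' a c).differentiableAt
  have hγs : ∀ t : ℝ, toC (γ t) = toC (γ 0) - (-(t : ℂ)) • toC (s t) := by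
    intro t
    ext a c
    have := sub_smul_dslope (fun t => γ t a c) 0 t
    rw [sub_zero, smul_eq_mul] at this
    simp only [toC, hs, Matrix.map_apply, Matrix.sub_apply, Matrix.smul_apply, Matrix.of_apply,
      smul_eq_mul, neg_mul, sub_neg_eq_add, ← Complex.ofReal_mul, this, ← Complex.ofReal_add]
    rw [add_sub_cancel]
  have hlin : Continuous fun M : Matrix (Fin n ⊕ Fin n) (Fin n ⊕ Fin n) ℂ =>
      LinearMap.toMatrix b b (Matrix.toLin' M) :=
    LinearMap.continuous_of_finiteDimensional
      ((LinearMap.toMatrix b b).toLinearMap ∘ₗ (Matrix.toLin' (R := ℂ)).toLinearMap)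
  have htoC : Continuous fun M : Matrix (Fin n ⊕ Fin n) (Fin n ⊕ Fin n) ℝ => toC M :=
    continuous_id.matrix_map Complex.continuous_ofReal
  have h := isLittleO_sum_neg_pow_sub (Nat.lt_succ_of_le hp)
    (fun r t => mixedDet k r (LinearMap.toMatrix b b (shiftMap (toC (γ 0)) lam))
        (LinearMap.toMatrix b b (Matrix.toLin' (toC (s t)))))
    (fun r => ((continuous_mixedDet k r _).comp (hlin.comp htoC)).continuousAt.comp hscont)
    (fun r hr t => h0 r hr _)
  rw [hsG] at h
  refine h.congr_left fun t => ?_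
  rw [hγs t, charCoeff_eq k _ _ _ _ b]

end Asymptotics

/-! ### Invertibility of `X` and identification of the minors with those of `d`. -/

section Minors

variable {n m : ℕ} {g : Matrix (Fin n ⊕ Fin n) (Fin n ⊕ Fin n) ℝ} {lam : ℂ} {j : Fin m → ℕ}
  {ξ : Fin m → ℕ → (Fin n ⊕ Fin n → ℂ)}
  {b : Module.Basis (Fin (2 * n)) ℂ (Fin n ⊕ Fin n → ℂ)}
  {e : ((i : Fin m) × Fin (j i)) → Fin (2 * n)}

theorem IsJordanBasis.mulVec_first {g : Matrix (Fin n ⊕ Fin n) (Fin n ⊕ Fin n) ℂ}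
    (h : IsJordanBasis g lam j ξ) (i : Fin m) : g *ᵥ ξ i 1 = lam • ξ i 1 := by
  simpa [h.zero] using h.chain i 0 (h.one_le i)

theorem IsJordanBasis.det_closedShift_ne_zero {g : Matrix (Fin n ⊕ Fin n) (Fin n ⊕ Fin n) ℂ}
    (h : IsJordanBasis g lam j ξ) (he : Function.Injective e)
    (hb : ∀ p, b (e p) = ξ p.1 (p.2 + 1)) :
    (closedShift h.one_le (LinearMap.toMatrix b b (shiftMap g lam)) e).det ≠ 0 := by
  rw [← mixedDet_sum_zero h.one_le he (h.isShift hb) 0, ← charCoeff_self, ← h.finrank_invSpace]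
  exact charCoeff_finrank_ne_zero g lam

/-- A linear form that vanishes on the range of `lam • 1 - g` and at the end of each Jordan chain
is zero. -/
theorem IsJordanBasis.functional_eq_zero {g : Matrix (Fin n ⊕ Fin n) (Fin n ⊕ Fin n) ℂ}
    (h : IsJordanBasis g lam j ξ) (f : (Fin n ⊕ Fin n → ℂ) →ₗ[ℂ] ℂ)
    (hf : ∀ x, f (shiftMap g lam x) = 0) (hend : ∀ i, f (ξ i (j i)) = 0) : f = 0 := by
  obtain ⟨b, e, he, hb⟩ := h.exists_basis
  set C := closedShift h.one_le (LinearMap.toMatrix b b (shiftMap g lam)) e with hC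
  -- `f` kills every column of `C`, and `C` is invertible.
  have hcomp : f ∘ₗ Matrix.toLin b b C = 0 := by
    refine b.ext fun c => ?_
    have := toLin_closedShift_apply h.one_le he hb f hf c
    by_cases hc : ∃ i, chainHead h.one_le e i = c
    · obtain ⟨i, hi⟩ := hc
      rw [LinearMap.comp_apply, this.1 i hi, hend, mul_zero, LinearMap.zero_apply]
    · exact this.2 (not_exists.1 hc)
  have hdet : IsUnit C.det := (h.det_closedShift_ne_zero he hb).isUnit
  have hinv : Matrix.toLin b b C ∘ₗ Matrix.toLin b b C⁻¹ = LinearMap.id := by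
    rw [← Matrix.toLin_mul, Matrix.mul_nonsing_inv _ hdet, Matrix.toLin_one]
  calc f = f ∘ₗ (Matrix.toLin b b C ∘ₗ Matrix.toLin b b C⁻¹) := by rw [hinv, LinearMap.comp_id]
    _ = 0 := by rw [← LinearMap.comp_assoc, hcomp, LinearMap.zero_comp]

theorem ne_zero_of_mul_star (hlam : lam * star lam = 1) : lam ≠ 0 := by
  rintro rfl
  simp at hlam

theorem kreinForm_shiftMap_eta (hg : g ∈ Matrix.symplecticGroup (Fin n) ℝ)
    (hlam : lam * star lam = 1) (h : IsJordanBasis (toC g) lam j ξ) (i : Fin m)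
    (x : Fin n ⊕ Fin n → ℂ) :
    kreinFunctional (etaVec lam ξ i 1) (shiftMap (toC g) lam x) = 0 := by
  rw [shiftMap, Matrix.toLin'_apply]
  refine kreinForm_sub_eq_zero hg hlam ?_ x
  rw [etaVec, Matrix.mulVec_smul, h.mulVec_first, smul_comm]

/-- A kernel vector of `X` yields a combination `y` of the `η_{i,1}` whose pairing kills the range
of `lam - g` and all chain ends. Then `y = 0` by nondegeneracy, contradicting independence of the
eigenvectors. -/
theorem isUnit_det_matX (hg : g ∈ Matrix.symplecticGroup (Fin n) ℝ)
    (hlam : lam * star lam = 1) (h : IsJordanBasis (toC g) lam j ξ) :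
    IsUnit (matX lam j ξ).det := by
  rw [isUnit_iff_ne_zero]
  intro hdet
  obtain ⟨v, hv0, hv⟩ := Matrix.exists_mulVec_eq_zero_iff.2 hdet
  have hlam0 : -Complex.I * lam ≠ 0 :=
    mul_ne_zero (neg_ne_zero.2 Complex.I_ne_zero) (ne_zero_of_mul_star hlam)
  -- The coefficients are conjugated because the form is conjugate-linear in its second variable.
  set y := ∑ i, star (v i) • etaVec lam ξ i 1 with hy
  have hky : ∀ x, kreinForm x y = ∑ i, kreinForm x (etaVec lam ξ i 1) * v i := by
    intro x
    rw [hy, kreinForm_sum_right]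
    refine Finset.sum_congr rfl fun i _ => ?_
    rw [kreinForm_smul_right, star_star, mul_comm]
  have hf : kreinFunctional y = 0 := by
    refine h.functional_eq_zero _ (fun x => ?_) (fun i => ?_)
    · refine (hky _).trans (Finset.sum_eq_zero fun i _ => ?_)
      have := kreinForm_shiftMap_eta hg hlam h i x
      change kreinForm _ _ = 0 at this
      rw [this, zero_mul]
    · have h1 : kreinFunctional y (etaVec lam ξ i (j i)) = 0 :=
        (hky _).trans (congrFun hv i)
      rw [etaVec, map_smul, smul_eq_mul] at h1
      exact (mul_eq_zero.1 h1).resolve_left (pow_ne_zero _ hlam0)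
  have hy0 : y = 0 := eq_zero_of_kreinForm_eq_zero fun x => LinearMap.congr_fun hf x
  have hli : LinearIndependent ℂ fun i => ξ i 1 :=
    h.linearIndependent.comp (fun i => ⟨i, ⟨0, h.one_le i⟩⟩) fun i i' hii => congrArg Sigma.fst hii
  refine hv0 (funext fun i => ?_)
  have h2 := Fintype.linearIndependent_iff.1 hli (fun i => star (v i) * (-Complex.I * lam)) (by
    simpa [etaVec, smul_smul, hy] using hy0) i
  simpa using (mul_eq_zero.1 h2).resolve_right hlam0

theorem functional_toLin_mul_head {g : Matrix (Fin n ⊕ Fin n) (Fin n ⊕ Fin n) ℂ}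
    (hj : ∀ i, 1 ≤ j i) (he : Function.Injective e) (hb : ∀ p, b (e p) = ξ p.1 (p.2 + 1))
    (f : (Fin n ⊕ Fin n → ℂ) →ₗ[ℂ] ℂ) (hf : ∀ x, f (shiftMap g lam x) = 0)
    (Y : Matrix (Fin (2 * n)) (Fin (2 * n)) ℂ) (c : Fin (2 * n)) :
    f (Matrix.toLin b b (closedShift hj (LinearMap.toMatrix b b (shiftMap g lam)) e * Y) (b c))
      = ∑ i, Y (chainHead hj e i) c * (-(-1) ^ j i * f (ξ i (j i))) := by
  rw [Matrix.toLin_mul b b b, LinearMap.comp_apply, Matrix.toLin_self b b Y]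
  simp only [map_sum, map_smul, smul_eq_mul]
  symm
  refine Finset.sum_of_injOn (chainHead hj e) (chainHead_injective hj he).injOn (by simp) ?_ ?_
  · intro c' _ hc'
    rw [(toLin_closedShift_apply hj he hb f hf c').2 fun i hi => hc' ⟨i, by simp, hi⟩, mul_zero]
  · intro i _
    rw [(toLin_closedShift_apply hj he hb f hf _).1 i rfl]

/-- Here `J A g ξ_{i,1} = lam J A ξ_{i,1}` and `(J x, y)_G = i⟨x, y⟩`; the factor `i lam` is minus
the one in `η_{i,1}`. -/
theorem kreinForm_deriv (A : Matrix (Fin n ⊕ Fin n) (Fin n ⊕ Fin n) ℝ)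
    (h : IsJordanBasis (toC g) lam j ξ) (i i' : Fin m) :
    kreinForm (toC (J2n n ℝ * A * g) *ᵥ ξ i 1) (etaVec lam ξ i' 1) = -matS A lam ξ i i' := by
  have h1 : toC (J2n n ℝ * A * g) *ᵥ ξ i 1 = J2n n ℂ *ᵥ (lam • (toC A *ᵥ ξ i 1)) := by
    rw [toC_mul, toC_mul, toC_J2n, ← Matrix.mulVec_mulVec, ← Matrix.mulVec_mulVec,
      h.mulVec_first, Matrix.mulVec_smul]
  rw [h1, kreinForm_J2n_mulVec, matS, Matrix.of_apply, herm_eq_dotProduct, herm_eq_dotProduct]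
  conv_rhs => rw [etaVec]
  rw [Matrix.mulVec_smul, smul_dotProduct, smul_dotProduct]
  simp only [smul_eq_mul, pow_one]
  ring

/-- Pairing the head columns of `C Y = D` with `η_{i',1}` gives `-S` on one side and a sum over
chain ends, hence over rows of `X`, on the other. `Λ` cancels the powers of `lam` and leaves only
signs. -/
theorem matD_apply (A : Matrix (Fin n ⊕ Fin n) (Fin n ⊕ Fin n) ℝ)
    (hg : g ∈ Matrix.symplecticGroup (Fin n) ℝ) (hlam : lam * star lam = 1)
    (h : IsJordanBasis (toC g) lam j ξ) (he : Function.Injective e)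
    (hb : ∀ p, b (e p) = ξ p.1 (p.2 + 1)) (Y : Matrix (Fin (2 * n)) (Fin (2 * n)) ℂ)
    (hY : closedShift h.one_le (LinearMap.toMatrix b b (shiftMap (toC g) lam)) e * Y =
      LinearMap.toMatrix b b (Matrix.toLin' (toC (J2n n ℝ * A * g)))) :
    matD A lam j ξ = (Y.submatrix (chainHead h.one_le e) (chainHead h.one_le e))ᵀ *
      Matrix.diagonal fun i => -(-1 : ℂ) ^ j i := by
  have hlam0 := ne_zero_of_mul_star hlam
  have hend : ∀ i i', kreinFunctional (etaVec lam ξ i' 1) (ξ i (j i))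
      = (Complex.I * lam⁻¹) ^ j i * matX lam j ξ i i' := by
    intro i i'
    have h1 : matX lam j ξ i i' = (-Complex.I * lam) ^ j i *
        kreinFunctional (etaVec lam ξ i' 1) (ξ i (j i)) := by
      rw [← smul_eq_mul, ← map_smul]
      rfl
    have h2 : Complex.I * lam⁻¹ * (-Complex.I * lam) = 1 := by
      field_simp
      simp
    rw [h1, ← mul_assoc, ← mul_pow, h2, one_pow, one_mul]
  have hS : matS A lam ξ = (Y.submatrix (chainHead h.one_le e) (chainHead h.one_le e))ᵀ *
      (Matrix.diagonal fun i => (-1 : ℂ) ^ j i * (Complex.I * lam⁻¹) ^ j i) * matX lam j ξ := by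
    ext i i'
    have h1 := functional_toLin_mul_head h.one_le he hb (kreinFunctional (etaVec lam ξ i' 1))
      (kreinForm_shiftMap_eta hg hlam h i') Y (chainHead h.one_le e i)
    have h2 : b (chainHead h.one_le e i) = ξ i 1 := hb _
    rw [hY, Matrix.toLin_toMatrix, h2, Matrix.toLin'_apply] at h1
    have h3 := (kreinForm_deriv A h i i').symm.trans h1
    rw [← neg_neg (matS A lam ξ i i'), h3, Matrix.mul_apply, ← Finset.sum_neg_distrib]
    refine Finset.sum_congr rfl fun l _ => ?_
    rw [hend, Matrix.mul_diagonal, Matrix.transpose_apply, Matrix.submatrix_apply]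
    ring
  rw [matD, hS, Matrix.mul_nonsing_inv_cancel_right _ _ (isUnit_det_matX hg hlam h), matLambda,
    Matrix.mul_assoc, Matrix.diagonal_mul_diagonal]
  congr 2
  funext i
  have h1 : (-1 : ℂ) ^ j i = (-1) ^ (j i - 1) * -1 := by
    rw [← pow_succ, Nat.sub_add_cancel (h.one_le i)]
  have h2 : (-1 : ℂ) ^ (j i - 1) * (-1) ^ (j i - 1) = 1 := by
    rw [← mul_pow]; simp
  have h3 : (Complex.I * lam⁻¹) ^ j i * (Complex.I * lam) ^ j i = (-1) ^ j i := by
    rw [← mul_pow]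
    congr 1
    field_simp
    simp
  calc _ = ((-1 : ℂ) ^ j i * (-1) ^ (j i - 1)) *
        ((Complex.I * lam⁻¹) ^ j i * (Complex.I * lam) ^ j i) := by ring
    _ = -((-1 : ℂ) ^ (j i - 1) * (-1) ^ (j i - 1)) * (-1) ^ j i := by rw [h3, h1]; ring
    _ = _ := by rw [h2]; ring

theorem principalMinor_matD (A : Matrix (Fin n ⊕ Fin n) (Fin n ⊕ Fin n) ℝ)
    (hg : g ∈ Matrix.symplecticGroup (Fin n) ℝ) (hlam : lam * star lam = 1)
    (h : IsJordanBasis (toC g) lam j ξ) (he : Function.Injective e)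
    (hb : ∀ p, b (e p) = ξ p.1 (p.2 + 1)) (Y : Matrix (Fin (2 * n)) (Fin (2 * n)) ℂ)
    (hY : closedShift h.one_le (LinearMap.toMatrix b b (shiftMap (toC g) lam)) e * Y =
      LinearMap.toMatrix b b (Matrix.toLin' (toC (J2n n ℝ * A * g)))) (I : Finset (Fin m)) :
    ((Y.submatrix (chainHead h.one_le e) (chainHead h.one_le e)).submatrix
      (fun i : I => (i : Fin m)) (fun i : I => (i : Fin m))).det
      = (-1) ^ I.card * (-1) ^ (∑ i ∈ I, j i) * principalMinor (matD A lam j ξ) I := by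
  set Z := Y.submatrix (chainHead h.one_le e) (chainHead h.one_le e)
  have h1 : (matD A lam j ξ).submatrix (fun i : I => (i : Fin m)) (fun i : I => (i : Fin m))
      = (Z.submatrix (fun i : I => (i : Fin m)) (fun i : I => (i : Fin m)))ᵀ *
        Matrix.diagonal fun i : I => -(-1 : ℂ) ^ j i := by
    ext a c
    rw [matD_apply A hg hlam h he hb Y hY]
    simp [Matrix.mul_diagonal, Z]
  have h2 : ∏ i : I, -(-1 : ℂ) ^ j i = (-1) ^ I.card * (-1) ^ (∑ i ∈ I, j i) := by
    rw [Finset.prod_coe_sort I fun i => -(-1 : ℂ) ^ j i, Finset.prod_neg, Finset.prod_pow_eq_pow_sum]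
  rw [principalMinor, h1, Matrix.det_mul, Matrix.det_transpose, Matrix.det_diagonal, h2,
    mul_comm (Matrix.det _), ← mul_assoc]
  have h3 : ((-1 : ℂ) ^ I.card * (-1) ^ (∑ i ∈ I, j i)) *
      ((-1 : ℂ) ^ I.card * (-1) ^ (∑ i ∈ I, j i)) = 1 := by
    rw [mul_mul_mul_comm, ← mul_pow, ← mul_pow]; simp
  rw [h3, one_mul]

end Minors

/-! ### The leading coefficient in terms of `d`. -/

section Leading

variable {n m : ℕ} {g : Matrix (Fin n ⊕ Fin n) (Fin n ⊕ Fin n) ℝ} {lam : ℂ} {j : Fin m → ℕ}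
  {ξ : Fin m → ℕ → (Fin n ⊕ Fin n → ℂ)}
  {b : Module.Basis (Fin (2 * n)) ℂ (Fin n ⊕ Fin n → ℂ)}
  {e : ((i : Fin m) × Fin (j i)) → Fin (2 * n)}

theorem mixedDet_phi_eq_sum_principalMinor (A : Matrix (Fin n ⊕ Fin n) (Fin n ⊕ Fin n) ℝ)
    (hg : g ∈ Matrix.symplecticGroup (Fin n) ℝ) (hlam : lam * star lam = 1)
    (h : IsJordanBasis (toC g) lam j ξ) (he : Function.Injective e)
    (hb : ∀ p, b (e p) = ξ p.1 (p.2 + 1)) {k : ℕ} (hk : k < ∑ i, j i)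
    (ht : k = tailSize j (phi j k)) :
    (-1) ^ phi j k * mixedDet k (phi j k) (LinearMap.toMatrix b b (shiftMap (toC g) lam))
        (LinearMap.toMatrix b b (Matrix.toLin' (toC (J2n n ℝ * A * g))))
      = (-1) ^ (∑ i, j i - k) * charCoeff (toC g) lam (∑ i, j i) *
        ∑ I ∈ biggestBlockSets j k, principalMinor (matD A lam j ξ) I := by
  set C := closedShift h.one_le (LinearMap.toMatrix b b (shiftMap (toC g) lam)) e with hC
  set D := LinearMap.toMatrix b b (Matrix.toLin' (toC (J2n n ℝ * A * g))) with hD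
  have hdet : IsUnit C.det := (h.det_closedShift_ne_zero he hb).isUnit
  have hY : C * (C⁻¹ * D) = D := Matrix.mul_nonsing_inv_cancel_left _ _ hdet
  rw [mixedDet_phi_eq_sum_minors h.one_le h.antitone he (h.isShift hb) D _ hY hk ht,
    charCoeff_self _ D b, mixedDet_sum_zero h.one_le he (h.isShift hb), ← hC, Finset.mul_sum,
    Finset.mul_sum, Finset.mul_sum]
  refine Finset.sum_congr rfl fun I hI => ?_
  have hI' := (mem_biggestBlockSets_iff h.antitone hk ht I).1 hI
  -- Every admissible `I` has the same total size, so all its minors carry the same sign.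
  have hsum : ∑ i ∈ I, j i = ∑ i, j i - k := by
    have := Finset.sum_add_sum_compl I j
    omega
  rw [principalMinor_matD A hg hlam h he hb _ hY, hI'.1, hsum]
  have h1 : (-1 : ℂ) ^ phi j k * (-1) ^ phi j k = 1 := by
    rw [← mul_pow]; simp
  linear_combination (C.det * ((-1) ^ (∑ i, j i - k) * principalMinor (matD A lam j ξ) I)) * h1

end Leading

end SymplecticPath

/-! ### Assembly of the statements. -/

theorem mainTheorem3 (n : ℕ)
    -- the linear Hamiltonian system
    (A γ : ℝ → Matrix (Fin n ⊕ Fin n) (Fin n ⊕ Fin n) ℝ)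
    (hA : Continuous A) (hAsymm : ∀ t, (A t).IsSymm)
    (hγ : ∀ t, HasDerivAt γ (SymplecticPath.J2n n ℝ * A t * γ t) t)
    (hγ0 : γ 0 ∈ Matrix.symplecticGroup (Fin n) ℝ)
    -- the eigenvalue and its Jordan blocks
    (θ₀ : ℝ) (lam : ℂ) (hlam : lam = Complex.exp (Complex.I * θ₀))
    (heig : Module.End.HasEigenvalue (Matrix.toLin' (SymplecticPath.toC (γ 0))) lam)
    (m : ℕ) (j : Fin m → ℕ) (ξ : Fin m → ℕ → (Fin n ⊕ Fin n → ℂ))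
    (hξ : SymplecticPath.IsJordanBasis (SymplecticPath.toC (γ 0)) lam j ξ)
    (s : ℕ) (mult size : Fin s → ℕ) (hgroup : SymplecticPath.IsGrouping j mult size)
    -- abbreviations
    (c : ℕ → ℝ → ℂ)
    (hc : ∀ k t, c k t = SymplecticPath.charCoeff (SymplecticPath.toC (γ t)) lam k)
    (N : ℕ)
    (hN : N = Module.finrank ℂ (SymplecticPath.invSpace (SymplecticPath.toC (γ 0)) lam))
    (φ : ℕ → ℕ) (hφ : φ = SymplecticPath.phi j)
    (d : Matrix (Fin m) (Fin m) ℂ) (hd : d = SymplecticPath.matD (A 0) lam j ξ) :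
    N = ∑ i, j i ∧
    IsUnit (SymplecticPath.matX lam j ξ).det ∧
    Tendsto (fun z : ℂ => (z • (1 : Matrix (Fin n ⊕ Fin n) (Fin n ⊕ Fin n) ℂ)
        - SymplecticPath.toC (γ 0)).det / (z - lam) ^ N) (𝓝[≠] lam) (𝓝 (c N 0)) ∧
    (∀ k < N,
      IsLeast {r : ℕ | 1 ≤ r ∧ r ≤ m ∧ N - k ≤ SymplecticPath.headSize j r} (φ k) ∧
      IsLeast {r : ℕ | 1 ≤ r ∧ r ≤ m ∧ SymplecticPath.tailSize j r ≤ k} (φ k) ∧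
      (fun t : ℝ => c k t - (-(t : ℂ)) ^ φ k *
          SymplecticPath.mixedWedgeScalar (2 * n) (2 * n - k - φ k) (φ k)
            (Matrix.toLin' (lam • (1 : Matrix (Fin n ⊕ Fin n) (Fin n ⊕ Fin n) ℂ)
              - SymplecticPath.toC (γ 0)))
            (Matrix.toLin' (SymplecticPath.toC (deriv γ 0))))
        =o[𝓝 0] (fun t : ℝ => t ^ φ k) ∧
      (k = SymplecticPath.tailSize j (φ k) →
        (fun t : ℝ => c k t - (-1) ^ (N - k) * (t : ℂ) ^ φ k * c N 0 *
            ∑ I ∈ SymplecticPath.biggestBlockSets j k, SymplecticPath.principalMinor d I)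
          =o[𝓝 0] (fun t : ℝ => t ^ φ k) ∧
        ∀ l : Fin s, k = ∑ l' ∈ Finset.Ioi l, mult l' * size l' ↔
          φ k = ∑ l' ∈ Finset.Iic l, mult l')) ∧
    (∀ (l : Fin s) (k : ℕ), k = ∑ l' ∈ Finset.Ioi l, mult l' * size l' →
      k < N ∧ k = SymplecticPath.tailSize j (φ k) ∧
      SymplecticPath.biggestBlockSets j k =
        {SymplecticPath.firstBlocks m (∑ l' ∈ Finset.Iic l, mult l')} ∧
      (fun t : ℝ => c k t - (-1) ^ (N - k) * (t : ℂ) ^ φ k * c N 0 *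
          SymplecticPath.principalMinor d (SymplecticPath.firstBlocks m (φ k)))
        =o[𝓝 0] (fun t : ℝ => t ^ φ k)) := by
  subst hφ hd
  have hNj : N = ∑ i, j i := hN.trans hξ.finrank_invSpace
  have hlam1 : lam * star lam = 1 := by
    rw [hlam, mul_comm Complex.I, Complex.star_def, Complex.mul_conj, Complex.normSq_eq_norm_sq,
      Complex.norm_exp_ofReal_mul_I]
    simp
  have hderiv : deriv γ 0 = SymplecticPath.J2n n ℝ * A 0 * γ 0 :=
    HasDerivAt.deriv (F := Fin n ⊕ Fin n → Fin n ⊕ Fin n → ℝ) (hγ 0)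
  obtain ⟨b, e, he, hb⟩ := hξ.exists_basis
  have hP := hξ.isShift hb
  have hj := hξ.one_le
  have hcN : ∀ k < N, SymplecticPath.charCoeff (SymplecticPath.toC (γ 0)) lam k = 0 := by
    intro k hk
    rw [SymplecticPath.charCoeff_self k 0 b]
    -- The case `r = 0`, which lies below `φ(k) ≥ 1`.
    refine SymplecticPath.mixedDet_eq_zero_of_lt_tailSize hj hξ.antitone he hP 0
      (SymplecticPath.lt_tailSize_of_lt_phi (hNj ▸ hk) ?_)
    exact (SymplecticPath.isLeast_phi (hNj ▸ hk)).1.1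
  have hN2 : N ≤ 2 * n := by
    have h1 := Submodule.finrank_le
      (SymplecticPath.invSpace (SymplecticPath.toC (γ 0)) lam)
    simp only [Module.finrank_fintype_fun_eq_card, Fintype.card_sum, Fintype.card_fin] at h1
    omega
  have hmain : ∀ k < N, (fun t : ℝ => c k t - (-(t : ℂ)) ^ SymplecticPath.phi j k *
      SymplecticPath.mixedDet k (SymplecticPath.phi j k)
        (LinearMap.toMatrix b b (SymplecticPath.shiftMap (SymplecticPath.toC (γ 0)) lam))
        (LinearMap.toMatrix b b (Matrix.toLin' (SymplecticPath.toC
          (SymplecticPath.J2n n ℝ * A 0 * γ 0)))))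
      =o[𝓝 0] fun t : ℝ => t ^ SymplecticPath.phi j k := by
    intro k hk
    have hk' : k < ∑ i, j i := hNj ▸ hk
    have hle := SymplecticPath.add_phi_le hj hk'
    simp only [hc]
    refine SymplecticPath.isLittleO_charCoeff_sub (hγ 0) lam b (by omega) fun r hr D => ?_
    exact SymplecticPath.mixedDet_eq_zero_of_lt_tailSize hj hξ.antitone he hP D
      (SymplecticPath.lt_tailSize_of_lt_phi hk' hr)
  have hlead : ∀ k < N, k = SymplecticPath.tailSize j (SymplecticPath.phi j k) →
      (fun t : ℝ => c k t - (-1) ^ (N - k) * (t : ℂ) ^ SymplecticPath.phi j k * c N 0 *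
        ∑ I ∈ SymplecticPath.biggestBlockSets j k,
          SymplecticPath.principalMinor (SymplecticPath.matD (A 0) lam j ξ) I)
      =o[𝓝 0] fun t : ℝ => t ^ SymplecticPath.phi j k := by
    intro k hk ht
    have h := SymplecticPath.mixedDet_phi_eq_sum_principalMinor (A 0) hγ0 hlam1 hξ he hb
      (hNj ▸ hk) ht
    rw [← hNj, ← hc N 0] at h
    refine (hmain k hk).congr_left fun t => ?_
    rw [neg_pow]
    linear_combination (-(t : ℂ) ^ SymplecticPath.phi j k) * h
  refine ⟨hNj, SymplecticPath.isUnit_det_matX hγ0 hlam1 hξ, ?_, ?_, ?_⟩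
  · rw [hc]
    exact SymplecticPath.tendsto_charpoly_div_pow _ _ _ hcN
  · intro k hk
    have hk' : k < ∑ i, j i := hNj ▸ hk
    refine ⟨?_, SymplecticPath.isLeast_phi hk', ?_, fun ht => ⟨hlead k hk ht, fun l => ?_⟩⟩
    · convert SymplecticPath.isLeast_phi_headSize hk' using 5
      omega
    · have hle := SymplecticPath.add_phi_le hj hk'
      -- The bound needed is `k + φ(k) ≤ N ≤ 2n`.
      rw [SymplecticPath.mixedWedgeScalar_eq_mixedDet b (by omega), hderiv]
      exact hmain k hk
    · rw [← SymplecticPath.tailSize_sum_Iic hgroup]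
      -- Both sides are now values of `tailSize`, which is injective on `r ≤ m`.
      conv_lhs => rw [ht]
      exact SymplecticPath.tailSize_eq_iff hj (SymplecticPath.isLeast_phi hk').1.2.1
        (SymplecticPath.sum_Iic_le hgroup l)
  · rintro l k rfl
    have hk := SymplecticPath.corner_lt hj hgroup l
    have hφ := SymplecticPath.phi_corner hj hgroup l
    have ht := SymplecticPath.tailSize_sum_Iic hgroup l
    rw [← hφ] at ht
    have hB := SymplecticPath.biggestBlockSets_corner hj hξ.antitone hgroup l
    have h := hlead _ (hNj ▸ hk) ht.symm
    rw [hB, Finset.sum_singleton, ← hφ] at h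
    exact ⟨hNj ▸ hk, ht.symm, hB, h⟩
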